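/- Let $R>2$ and let $L_1=\{w-1+(w-1)^{-1}:|w|=R\}$. Let $G_1$ be the interior of the Jordan curve $L_1$ and $\Omega_1$ the unbounded component of $\overline{\mathbb C}\setminus L_1$, and let $\varphi$ be any conformal map of $G_1$ onto the open unit disk. Let $$\psi(w)=Rw-1+\frac1{Rw-1},\qquad v_{z,\pm}=\frac{z+2\pm\sqrt{z^2-4}}{2R},$$ where $\sqrt{z^2-4}$ is the branch in $\mathbb C\setminus[-2,2]$ that is positive on $(2,\infty)$, extended to $[-2,2]$ by its boundary values from the upper half plane. Let $\rho\in[0,1)$ be the smallest number such that the restriction of $\psi$ to $|w|>1$ has an analytic and univalent continuation to $|w|>\rho$. For a number $\mu\ge 0$ such that $\varphi(\psi(w))$ has a meromorphic continuation $h_\varphi$ to $\mu<|w|<1/\rho$, let $\Sigma$ be the set of all $z\in G_1$ for which the equation $h_\varphi(w)=\varphi(z)$ has a solution in $\mu<|w|<1$, let $\Sigma_0=G_1\setminus\Sigma$, and for $p\ge1$ let $\Sigma_p$ be the set of all $z\in\Sigma$ such that those solutions in $\mu<|w|<1$ that have largest modulus are finite in number and have multiplicities adding up to $p$. Then $\psi$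 is the conformal map of $1<|w|\le\infty$ onto $\Omega_1$ with $\psi(\infty)=\infty$ and $\psi'(\infty)>0$. The smallest $\mu\ge0$ for which such a continuation $h_\varphi$ exists is attained and equals $$\mu=\frac{R-\sqrt{R^2-4}}2 .$$ For this $\mu$, one has $\Sigma=\{z\in G_1:|v_{z,+}|>\mu\}$; if $z\in\Sigma$ and $\omega$ is a solution of largest modulus of $h_\varphi(w)=\varphi(z)$ in $\mu<|w|<1$, then $\omega\in\{v_{z,+},v_{z,-}\}$; and $$G_1=\Sigma_1\cup\Sigma_2\cup\Sigma_0,$$ where $$\Sigma_1=\psi\left(\{w:\ \mu<|w|<1,\ |w-1/R|>1/R\}\right),\qquad \Sigma_2=(x_\mu,2],\qquad x_\mu=(1+\mu^2)^2-2 .$$ -/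

import Mathlib

noncomputable section

namespace ZhukovskyDomain

/-! ### General notions: the two domains of a curve, the conformal maps, and the sets `Σ_p` -/

/-- The interior of a Jordan curve `L`: the union of the bounded components of its complement. -/
def interiorDomain (L : Set ℂ) : Set ℂ :=
  {z | z ∈ Lᶜ ∧ Bornology.IsBounded (connectedComponentIn Lᶜ z)}

/-- The exterior of a Jordan curve `L`, without the point at infinity:
the unbounded component of its complement. -/
def exteriorDomain (L : Set ℂ) : Set ℂ :=
  {z | z ∈ Lᶜ ∧ ¬ Bornology.IsBounded (connectedComponentIn Lᶜ z)}

/-- The annulus `r < |w| < ∞`. -/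
def outside (r : ℝ) : Set ℂ := {w | r < ‖w‖}

/-- The annulus `r < |w| < s`. -/
def annulus (r s : ℝ) : Set ℂ := {w | r < ‖w‖ ∧ ‖w‖ < s}

/-- The annulus `m < |w| < 1 / ρ` (with outer radius `∞` if `ρ = 0`). -/
def wideAnnulus (m ρ : ℝ) : Set ℂ := {w | m < ‖w‖ ∧ ρ * ‖w‖ < 1}

/-- `ψ` maps `1 < |w| ≤ ∞` conformally onto the exterior of `L` (point at infinity included), with
`ψ(∞) = ∞` and `ψ'(∞) > 0`; both conditions at infinity are expressed by
`ψ(w) / w → c`, where `0 < c < ∞`. -/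
structure IsExteriorMap (L : Set ℂ) (ψ : ℂ → ℂ) : Prop where
  differentiableOn : DifferentiableOn ℂ ψ (outside 1)
  bijOn : Set.BijOn ψ (outside 1) (exteriorDomain L)
  deriv_infty_pos : ∃ c : ℝ, 0 < c ∧
    Filter.Tendsto (fun w => ψ w / w) (Bornology.cobounded ℂ) (nhds (c : ℂ))

/-- `φ` maps `G` conformally onto the open unit disk. -/
structure IsInteriorMap (G : Set ℂ) (φ : ℂ → ℂ) : Prop where
  differentiableOn : DifferentiableOn ℂ φ G
  bijOn : Set.BijOn φ G (Metric.ball 0 1)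

/-- The smallest `ρ ∈ [0, 1)` such that `ψ`, given on `|w| > 1`, has an analytic and univalent
continuation to `|w| > ρ`. -/
def rho (ψ : ℂ → ℂ) : ℝ :=
  sInf {r : ℝ | 0 ≤ r ∧ r < 1 ∧ ∃ g : ℂ → ℂ,
    DifferentiableOn ℂ g (outside r) ∧ Set.InjOn g (outside r) ∧ Set.EqOn g ψ (outside 1)}

/-- `h` is a meromorphic continuation of `φ ∘ ψ` to `m < |w| < 1 / ρ`, where `ρ = rho ψ`.
The function `φ` is given on the interior domain, so that `φ ∘ ψ` is given on `ρ < |w| < 1`.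
Normal form means that `h` has no removable singularities: it is analytic wherever it
is not infinite. (Its value at a pole is a convention, which is never used.) -/
def IsMeromorphicContinuation (ψ φ : ℂ → ℂ) (m : ℝ) (h : ℂ → ℂ) : Prop :=
  MeromorphicNFOn h (wideAnnulus m (rho ψ)) ∧
    ∀ w ∈ annulus (rho ψ) 1, h w = φ (ψ w)

/-- The radii `m ≥ 0` such that `φ ∘ ψ` has a meromorphic continuation to `m < |w| < 1 / ρ`. -/
def continuationRadii (ψ φ : ℂ → ℂ) : Set ℝ :=
  {m | 0 ≤ m ∧ ∃ h : ℂ → ℂ, IsMeromorphicContinuation ψ φ m h}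

/-- The solutions of `h(w) = φ(z)` in `μ < |w| < 1`; poles of `h` are not solutions. -/
def solutions (φ h : ℂ → ℂ) (μ : ℝ) (z : ℂ) : Set ℂ :=
  {w | w ∈ annulus μ 1 ∧ AnalyticAt ℂ h w ∧ h w = φ z}

/-- The solutions of `h(w) = φ(z)` in `μ < |w| < 1` that have largest modulus. -/
def largestSolutions (φ h : ℂ → ℂ) (μ : ℝ) (z : ℂ) : Set ℂ :=
  {ω | ω ∈ solutions φ h μ z ∧ ∀ w ∈ solutions φ h μ z, ‖w‖ ≤ ‖ω‖}

/-- The set `Σ` of the points `z ∈ G` for which `h(w) = φ(z)` has a solution in `μ < |w| < 1`. -/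
def sigma (G : Set ℂ) (φ h : ℂ → ℂ) (μ : ℝ) : Set ℂ :=
  {z | z ∈ G ∧ (solutions φ h μ z).Nonempty}

/-- `Σ_0 = G ∖ Σ`. -/
def sigmaZero (G : Set ℂ) (φ h : ℂ → ℂ) (μ : ℝ) : Set ℂ :=
  G \ sigma G φ h μ

/-- For `p ≥ 1`, the set `Σ_p` of the points `z ∈ Σ` for which the solutions of largest modulus of
`h(w) = φ(z)` are finite in number and have multiplicities that add up to `p`. -/
def sigmaP (G : Set ℂ) (φ h : ℂ → ℂ) (μ : ℝ) (p : ℕ) : Set ℂ :=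
  {z | z ∈ sigma G φ h μ ∧ (largestSolutions φ h μ z).Finite ∧
    ∑ᶠ ω ∈ largestSolutions φ h μ z, analyticOrderNatAt (fun w => h w - φ z) ω = p}

/-! ### The particular curve -/

/-- The curve `{w - 1 + 1 / (w - 1) : |w| = R}`. -/
def curve (R : ℝ) : Set ℂ :=
  {z | ∃ w : ℂ, ‖w‖ = R ∧ z = w - 1 + (w - 1)⁻¹}

/-- `ψ(w) = R w - 1 + 1 / (R w - 1)`. -/
def psi (R : ℝ) (w : ℂ) : ℂ := R * w - 1 + (R * w - 1)⁻¹

/-- The branch of `√(z² - 4)` in `ℂ ∖ [-2, 2]` that is positive on `(2, ∞)`, extended to `[-2, 2]`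
by its boundary values from the upper half plane. Both factors are principal square roots: across
`(-∞, -2)` they change sign together, and on `[-2, 2]` the product is `i √(4 - z²)`. -/
def sqrtBranch (z : ℂ) : ℂ := (z - 2) ^ (1 / 2 : ℂ) * (z + 2) ^ (1 / 2 : ℂ)

/-- `v_{z,+}`. -/
def vPlus (R : ℝ) (z : ℂ) : ℂ := (z + 2 + sqrtBranch z) / (2 * R)

/-- `v_{z,-}`. -/
def vMinus (R : ℝ) (z : ℂ) : ℂ := (z + 2 - sqrtBranch z) / (2 * R)

end ZhukovskyDomain

end

/-! ### Cauchy integrals on circles and annuli. -/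

namespace ZhukovskyDomain

open Complex Metric Set Filter Topology MeasureTheory Real ComplexConjugate

/-! With `u = R w - 1` one has `psi R w = u + u⁻¹`, and `u ↦ u⁻¹` exchanges the two preimages of a
point. The preimage of the interior is `innerPreimage R`, where both preimages have modulus less
than `1`. Write `R = μ + μ⁻¹` with `0 < μ < 1`. The disk automorphism `diskMap μ` carries the
annulus `μ² < |t| < 1` onto this set and turns the exchange into `t ↦ μ² / t`.

In the coordinate `t`, the function `φ ∘ ψ` is invariant under `t ↦ μ² / t`, and its modulus tends
to `1` at the unit circle. Schwarz reflection and the invariance together give `H (μ² t) = 1 / conj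
(H (conj t))`, hence a meromorphic continuation to `t ≠ 0` with multiplicative period `μ⁴`
(`exists_meromorphic_extension`, `exists_isPeriodicContinuation`). Here `t = 0` is `w = μ`, and `t =
∞` is `w = 1 / μ`, which lies beyond `|w| = R / 2 = 1 / ρ`. No continuation is meromorphic at `μ`:
each value recurs along `μ^(4j) s → 0`, so the continuation would equal two different constants near
`μ` (`le_of_isMeromorphicContinuation`).

For a solution `w`, write its coordinate as `μ^(4j) s` with `μ⁴ ≤ |s| < 1`. If `|s| ≤ μ²`, then `|H|
≥ 1` at points arbitrarily near `s`, which excludes the value `φ(z)`. Otherwise `s` is the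
coordinate of `v₊` or `v₋`. Scaling `t` by `μ²` is `w ↦ 1 / (R - w)`, which lowers the modulus as
long as the result exceeds `μ` (`norm_diskMap_sq_mul_lt`); so the largest solutions are among `v₊`,
`v₋` (`eq_or_norm_lt_of_mem_solutions`). Finally `|v₋| ≤ |v₊|`, with equality exactly when `|R v₊ -
1| = 1`, that is, on `[-2, 2]`; there the multiplicities add up to `2`. -/

lemma differentiableAt_circleIntegral_div_sub {f : ℂ → ℂ} {r : ℝ} (hr : 0 < r)
    (hf : ContinuousOn f (sphere 0 r)) {ζ : ℂ} (hζ : ‖ζ‖ ≠ r) :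
    DifferentiableAt ℂ (fun ζ => ∮ w in C(0, r), f w / (w - ζ)) ζ := by
  obtain ⟨M, hM⟩ := (isCompact_sphere (0 : ℂ) r).exists_bound_of_continuousOn hf
  set δ : ℝ := |‖ζ‖ - r| with hδ
  have hδ0 : 0 < δ := abs_pos.2 (sub_ne_zero.2 hζ)
  have hcm : ∀ θ, circleMap 0 r θ ∈ sphere (0 : ℂ) r := fun θ => circleMap_mem_sphere 0 hr.le θ
  have hdist : ∀ x ∈ ball ζ (δ / 2), ∀ θ, δ / 2 ≤ ‖circleMap 0 r θ - x‖ := by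
    intro x hx θ
    have h1 : ‖circleMap 0 r θ‖ = r := by simpa using hcm θ
    have h2 : δ ≤ ‖ζ - circleMap 0 r θ‖ := by
      have := abs_norm_sub_norm_le ζ (circleMap 0 r θ)
      rwa [h1] at this
    have h3 : ‖x - ζ‖ < δ / 2 := by simpa [dist_eq_norm] using hx
    have h4 : ‖ζ - circleMap 0 r θ‖ ≤ ‖x - ζ‖ + ‖circleMap 0 r θ - x‖ := by
      have : ζ - circleMap 0 r θ = -((x - ζ) + (circleMap 0 r θ - x)) := by ring
      rw [this, norm_neg]; exact norm_add_le _ _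
    linarith
  have hne : ∀ x ∈ ball ζ (δ / 2), ∀ θ, circleMap 0 r θ - x ≠ 0 := fun x hx θ h => by
    have := hdist x hx θ
    rw [h, norm_zero] at this; linarith
  have hfc : Continuous fun θ => f (circleMap 0 r θ) :=
    hf.comp_continuous (continuous_circleMap 0 r) hcm
  have hcont : ∀ n : ℕ, ∀ x ∈ ball ζ (δ / 2), Continuous fun θ =>
      circleMap 0 r θ * I * (f (circleMap 0 r θ) / (circleMap 0 r θ - x) ^ n) := by
    intro n x hx
    refine Continuous.mul (by fun_prop) (hfc.div (by fun_prop) ?_)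
    exact fun θ => pow_ne_zero _ (hne x hx θ)
  have key := intervalIntegral.hasDerivAt_integral_of_dominated_loc_of_deriv_le
    (μ := volume) (a := 0) (b := 2 * π) (x₀ := ζ) (s := ball ζ (δ / 2))
    -- The exponent `1` lets `hcont` serve both the integrand and, with exponent `2`, its
    -- derivative.
    (F := fun x θ => circleMap 0 r θ * I * (f (circleMap 0 r θ) / (circleMap 0 r θ - x) ^ 1))
    (F' := fun x θ => circleMap 0 r θ * I * (f (circleMap 0 r θ) / (circleMap 0 r θ - x) ^ 2))
    (bound := fun _ => r * (M / (δ / 2) ^ 2))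
    (ball_mem_nhds _ (by positivity)) ?_ ?_ ?_ ?_ ?_ ?_
  · have := key.2.differentiableAt
    simpa [circleIntegral] using this
  · filter_upwards [ball_mem_nhds ζ (show 0 < δ / 2 by positivity)] with x hx
    exact (hcont 1 x hx).aestronglyMeasurable
  · exact (hcont 1 ζ (mem_ball_self (by positivity))).intervalIntegrable _ _
  · exact (hcont 2 ζ (mem_ball_self (by positivity))).aestronglyMeasurable
  · refine Eventually.of_forall fun θ _ x hx => ?_
    have h1 : ‖circleMap 0 r θ‖ = r := by simpa using hcm θ
    rw [norm_mul, norm_mul, norm_I, mul_one, h1, norm_div, norm_pow]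
    gcongr
    · exact (norm_nonneg _).trans (hM _ (hcm θ))
    · exact hM _ (hcm θ)
    · exact hdist x hx θ
  · exact intervalIntegrable_const
  · refine Eventually.of_forall fun θ _ x hx => ?_
    have hx0 := hne x hx θ
    have h1 : HasDerivAt (fun x => circleMap 0 r θ - x) (-1) x := by
      simpa using (hasDerivAt_id x).const_sub (circleMap 0 r θ)
    have h2 := ((h1.fun_inv hx0).const_mul (f (circleMap 0 r θ))).const_mul (circleMap 0 r θ * I)
    simpa [div_eq_mul_inv] using h2

/-- **Cauchy's formula for an annulus.** -/
lemma circleIntegral_annulus_sub {f : ℂ → ℂ} {a b : ℝ} (ha : 0 < a) {ζ : ℂ} (h1 : a < ‖ζ‖)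
    (h2 : ‖ζ‖ < b) (hf : ∀ z, a ≤ ‖z‖ → ‖z‖ ≤ b → DifferentiableAt ℂ f z) :
    (∮ w in C(0, b), f w / (w - ζ)) - (∮ w in C(0, a), f w / (w - ζ)) = 2 * π * I * f ζ := by
  have hζ : DifferentiableAt ℂ f ζ := hf ζ h1.le h2.le
  have hb : 0 < b := ha.trans (h1.trans h2)
  -- Splitting off the pole: `dslope f ζ` has equal integrals over both circles, and only `(w -
  -- ζ)⁻¹` distinguishes them.
  have hint : ∀ r, 0 < r → a ≤ r → r ≤ b → r ≠ ‖ζ‖ →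
      (∮ w in C(0, r), f w / (w - ζ)) =
        (∮ w in C(0, r), dslope f ζ w) + f ζ * ∮ w in C(0, r), (w - ζ)⁻¹ := by
    intro r hr har hrb hne
    have hne' : ∀ w ∈ sphere (0 : ℂ) r, w ≠ ζ := fun w hw h => hne (by
      rw [← h]; simpa using hw.symm)
    have hcf : ContinuousOn f (sphere 0 r) := fun w hw => by
      have : ‖w‖ = r := by simpa using hw
      exact (hf w (by linarith) (by linarith)).continuousAt.continuousWithinAt
    have hci : ContinuousOn (fun w => (w - ζ)⁻¹) (sphere 0 r) :=
      ContinuousOn.inv₀ (by fun_prop) fun w hw => sub_ne_zero.2 (hne' w hw)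
    rw [← circleIntegral.integral_const_mul, ← circleIntegral.integral_add]
    · refine circleIntegral.integral_congr hr.le fun w hw => ?_
      rw [dslope_of_ne _ (hne' w hw), slope_def_field]
      have := sub_ne_zero.2 (hne' w hw)
      field_simp; ring
    · refine ContinuousOn.circleIntegrable hr.le ?_
      have : ContinuousOn (fun w => (f w - f ζ) * (w - ζ)⁻¹) (sphere 0 r) :=
        (hcf.sub continuousOn_const).mul hci
      refine this.congr fun w hw => ?_
      rw [dslope_of_ne _ (hne' w hw), slope_def_field, div_eq_mul_inv]
    · exact (continuousOn_const.mul hci).circleIntegrable hr.le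
  have hds : ∀ z, a ≤ ‖z‖ → ‖z‖ ≤ b → ContinuousAt (dslope f ζ) z := by
    intro z hz1 hz2
    by_cases h : z = ζ
    · rw [h]; exact continuousAt_dslope_same.2 hζ
    · exact (continuousAt_dslope_of_ne h).2 (hf z hz1 hz2).continuousAt
  have heq := Complex.circleIntegral_eq_of_differentiable_on_annulus_off_countable (c := 0)
    (f := dslope f ζ) ha (h1.trans h2).le (countable_singleton ζ)
    (fun z hz => by
      simp only [Set.mem_sdiff, mem_closedBall, dist_zero_right, mem_ball, not_lt] at hz
      exact (hds z hz.2 hz.1).continuousWithinAt)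
    (fun z hz => by
      simp only [Set.mem_sdiff, mem_closedBall, dist_zero_right, mem_ball, not_le,
        mem_singleton_iff] at hz
      exact (differentiableAt_dslope_of_ne hz.2).2 (hf z hz.1.2.le hz.1.1.le))
  rw [hint b hb (h1.trans h2).le le_rfl h2.ne', hint a ha le_rfl (h1.trans h2).le h1.ne, heq,
    circleIntegral.integral_sub_inv_of_mem_ball (by simpa using h2)]
  have : (∮ w in C(0, a), (w - ζ)⁻¹) = 0 := by
    refine Complex.circleIntegral_eq_zero_of_differentiable_on_off_countable ha.le
      countable_empty ?_ ?_
    · refine ContinuousOn.inv₀ (by fun_prop) fun w hw h => ?_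
      rw [sub_eq_zero] at h; subst h
      simp at hw; linarith
    · intro w hw
      refine DifferentiableAt.inv (by fun_prop) fun h => ?_
      rw [sub_eq_zero] at h; subst h
      simp at hw; linarith
  rw [this]; ring

lemma circleIntegral_annulus_eq {f : ℂ → ℂ} {a b : ℝ} (ha : 0 < a) (hab : a ≤ b) {ζ : ℂ}
    (h : ‖ζ‖ < a ∨ b < ‖ζ‖) (hf : ∀ z, a ≤ ‖z‖ → ‖z‖ ≤ b → DifferentiableAt ℂ f z) :
    (∮ w in C(0, b), f w / (w - ζ)) = ∮ w in C(0, a), f w / (w - ζ) := by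
  have hd : ∀ z, a ≤ ‖z‖ → ‖z‖ ≤ b → DifferentiableAt ℂ (fun w => f w / (w - ζ)) z := by
    intro z h1 h2
    refine (hf z h1 h2).div (by fun_prop) fun h0 => ?_
    rw [sub_eq_zero] at h0; subst h0
    rcases h with h | h <;> linarith
  refine Complex.circleIntegral_eq_of_differentiable_on_annulus_off_countable ha hab
    countable_empty (fun z hz => ?_) (fun z hz => ?_)
  · simp only [Set.mem_sdiff, mem_closedBall, dist_zero_right, mem_ball, not_lt] at hz
    exact (hd z hz.2 hz.1).continuousAt.continuousWithinAt
  · simp only [Set.mem_sdiff, mem_closedBall, dist_zero_right, mem_ball, not_le] at hz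
    exact hd z hz.1.2.le hz.1.1.le

end ZhukovskyDomain

/-! ### Schwarz reflection in the unit circle. -/

namespace ZhukovskyDomain

open Complex Metric Set Filter Topology MeasureTheory Real ComplexConjugate

/-- The reflection `t ↦ 1 / conj t` in the unit circle. -/
noncomputable def reflection (t : ℂ) : ℂ := (conj t)⁻¹

lemma norm_reflection (t : ℂ) : ‖reflection t‖ = ‖t‖⁻¹ := by simp [reflection]

lemma reflection_reflection (t : ℂ) : reflection (reflection t) = t := by simp [reflection]

lemma differentiableAt_reflection_comp_reflection {f : ℂ → ℂ} {z : ℂ} (hz : z ≠ 0)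
    (hf : DifferentiableAt ℂ f (reflection z)) (h0 : f (reflection z) ≠ 0) :
    DifferentiableAt ℂ (fun w => reflection (f (reflection w))) z := by
  have h1 : DifferentiableAt ℂ (conj ∘ f ∘ conj) (z⁻¹) := by
    rw [differentiableAt_conj_conj_iff]
    simpa [reflection] using hf
  have h2 : DifferentiableAt ℂ (fun w => ((conj ∘ f ∘ conj) (w⁻¹))⁻¹) z := by
    refine DifferentiableAt.inv (h1.comp z (differentiableAt_inv hz)) ?_
    simpa [reflection] using h0
  simpa [reflection, Function.comp_def] using h2

lemma norm_sub_reflection_le {x : ℂ} (hx : 1 / 2 ≤ ‖x‖) : ‖x - reflection x‖ ≤ 3 * |‖x‖ - 1| := by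
  have hx0 : 0 < ‖x‖ := by linarith
  have hc : conj x ≠ 0 := by simpa using norm_pos_iff.1 hx0
  have h1 : x - reflection x = ((‖x‖ ^ 2 - 1 : ℝ) : ℂ) / conj x := by
    rw [reflection, eq_div_iff hc, sub_mul, inv_mul_cancel₀ hc, Complex.mul_conj,
      Complex.normSq_eq_norm_sq]
    push_cast; ring
  rw [h1, norm_div, Complex.norm_real, RCLike.norm_conj, Real.norm_eq_abs, div_le_iff₀ hx0,
    show ‖x‖ ^ 2 - 1 = (‖x‖ - 1) * (‖x‖ + 1) by ring, abs_mul,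
    abs_of_pos (show 0 < ‖x‖ + 1 by linarith)]
  nlinarith [abs_nonneg (‖x‖ - 1)]

lemma reflection_circleMap (r θ : ℝ) : reflection (circleMap 0 r θ) = circleMap 0 r⁻¹ θ := by
  simp only [reflection, circleMap, zero_add, map_mul, conj_ofReal, ← Complex.exp_conj, conj_I,
    mul_inv, ← Complex.exp_neg, ofReal_inv]
  congr 2; ring

/-- The difference of the Cauchy integrands at mirror points splits in two: one term is small
because `x` is near its reflection, the other because mirror points near the circle are close. -/
lemma norm_reflected_kernel_le {x w ζ : ℂ} {d : ℝ} (hd : 0 < d) (hx : 1 / 2 ≤ ‖x‖) (hw0 : w ≠ 0)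
    (hw1 : ‖w‖ ≤ 1) (hd1 : d ≤ ‖w - ζ‖) (hd2 : d ≤ ‖reflection w - ζ‖) :
    ‖w * I * (x / (w - ζ)) - reflection w * I * (reflection x / (reflection w - ζ))‖ ≤
      3 * |‖x‖ - 1| / d + 2 * ‖ζ‖ * (‖w‖⁻¹ - ‖w‖) / d ^ 2 := by
  have h1 : w - ζ ≠ 0 := fun h => by rw [h, norm_zero] at hd1; linarith
  have h2 : reflection w - ζ ≠ 0 := fun h => by rw [h, norm_zero] at hd2; linarith
  have hwp : 0 < ‖w‖ := norm_pos_iff.2 hw0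
  have e : w * I * (x / (w - ζ)) - reflection w * I * (reflection x / (reflection w - ζ)) =
      I * ((x - reflection x) * w / (w - ζ) +
        reflection x * ζ * (reflection w - w) / ((w - ζ) * (reflection w - ζ))) := by
    field_simp; ring
  have n1 : ‖reflection x‖ ≤ 2 := by
    rw [norm_reflection]
    exact inv_le_of_inv_le₀ (by norm_num) (by linarith)
  have n2 : ‖reflection w - w‖ = ‖w‖⁻¹ - ‖w‖ := by
    have : reflection w - w = ((‖w‖⁻¹ - ‖w‖ : ℝ) : ℂ) * (w / (‖w‖ : ℂ)) := by
      have hc : conj w ≠ 0 := by simpa using hw0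
      have hn : (‖w‖ : ℂ) ≠ 0 := by simpa using hw0
      have hm : w * conj w = (‖w‖ : ℂ) ^ 2 := by
        rw [Complex.mul_conj, Complex.normSq_eq_norm_sq]; push_cast; ring
      rw [reflection]
      push_cast
      field_simp
      linear_combination -hm
    rw [this, norm_mul, norm_div, Complex.norm_real, Complex.norm_real, norm_norm,
      div_self hwp.ne', mul_one, Real.norm_of_nonneg]
    have := (one_le_inv₀ hwp).2 hw1
    linarith
  rw [e, norm_mul, norm_I, one_mul]
  refine (norm_add_le _ _).trans (add_le_add ?_ ?_)
  · rw [norm_div, norm_mul]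
    have := norm_sub_reflection_le hx
    refine div_le_div₀ (by positivity) ?_ hd hd1
    calc ‖x - reflection x‖ * ‖w‖ ≤ ‖x - reflection x‖ * 1 := by gcongr
      _ ≤ 3 * |‖x‖ - 1| := by linarith
  · rw [norm_div, norm_mul, norm_mul, norm_mul, n2, sq]
    have := (one_le_inv₀ hwp).2 hw1
    have : 0 ≤ ‖w‖⁻¹ - ‖w‖ := by linarith
    gcongr

/-- **Schwarz reflection** for functions whose modulus tends to `1` at the unit circle. -/
theorem exists_reflection_extension {q : ℝ} (hq0 : 0 < q) (hq : q < 1) {F : ℂ → ℂ}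
    (hF : ∀ z, q < ‖z‖ → ‖z‖ < 1 → DifferentiableAt ℂ F z)
    (hlim : ∀ ε > 0, ∃ r < 1, ∀ z, r < ‖z‖ → ‖z‖ < 1 → |‖F z‖ - 1| < ε) :
    ∃ a E, q < a ∧ a < 1 ∧ (∀ z, a < ‖z‖ → ‖z‖ < a⁻¹ → DifferentiableAt ℂ E z) ∧
      (∀ z, a < ‖z‖ → ‖z‖ < 1 → E z = F z) ∧
      (∀ z, 1 < ‖z‖ → ‖z‖ < a⁻¹ → E z = reflection (F (reflection z))) := by
  obtain ⟨r₁, hr₁, hFr₁⟩ := hlim (1 / 2) (by norm_num)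
  obtain ⟨a, ha1, ha2⟩ := exists_between (max_lt hq hr₁)
  have hqa : q < a := (le_max_left _ _).trans_lt ha1
  have hra : r₁ < a := (le_max_right _ _).trans_lt ha1
  have ha0 : 0 < a := hq0.trans hqa
  have hlow : ∀ z, a ≤ ‖z‖ → ‖z‖ < 1 → 1 / 2 ≤ ‖F z‖ := fun z h1 h2 => by
    have := (abs_lt.1 (hFr₁ z (hra.trans_le h1) h2)).1
    linarith
  set Fs : ℂ → ℂ := fun w => reflection (F (reflection w)) with hFs
  have hFd : ∀ z, a ≤ ‖z‖ → ‖z‖ < 1 → DifferentiableAt ℂ F z :=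
    fun z h1 h2 => hF z (hqa.trans_le h1) h2
  have hFsd : ∀ z, 1 < ‖z‖ → ‖z‖ ≤ a⁻¹ → DifferentiableAt ℂ Fs z := by
    intro z h1 h2
    have hz0 : 0 < ‖z‖ := by linarith
    have h3 : a ≤ ‖reflection z‖ := by
      rw [norm_reflection]; exact (le_inv_comm₀ hz0 ha0).1 h2
    have h4 : ‖reflection z‖ < 1 := by rw [norm_reflection]; exact inv_lt_one_of_one_lt₀ h1
    refine differentiableAt_reflection_comp_reflection (norm_pos_iff.1 hz0) (hFd _ h3 h4) ?_
    have := hlow _ h3 h4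
    intro h; rw [h, norm_zero] at this; linarith
  -- Only `|F|` is controlled at the circle, so no boundary values are available. The mirror circles
  -- of radii `r` and `r⁻¹` replace an integral over the unit circle.
  have hJ : ∀ ζ : ℂ, ‖ζ‖ ≠ 1 → Tendsto (fun r : ℝ => (∮ w in C(0, r), F w / (w - ζ)) -
      ∮ w in C(0, r⁻¹), Fs w / (w - ζ)) (𝓝[<] 1) (𝓝 0) := by
    intro ζ hζ
    set d : ℝ := |1 - ‖ζ‖| / 2 with hd
    have hd0 : 0 < d := by
      have := abs_pos.2 (sub_ne_zero.2 hζ.symm)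
      positivity
    have hlt : ∀ᶠ r : ℝ in 𝓝[<] 1, r < 1 := self_mem_nhdsWithin
    have hgt : ∀ᶠ r : ℝ in 𝓝[<] 1, a < r :=
      nhdsWithin_le_nhds (Ioi_mem_nhds ha2)
    have hd1 : ∀ᶠ r : ℝ in 𝓝[<] 1, d < |r - ‖ζ‖| := by
      refine nhdsWithin_le_nhds (ContinuousAt.eventually_lt (by fun_prop) (by fun_prop) ?_)
      rw [hd]; linarith
    have hinv : ContinuousAt (fun r : ℝ => r⁻¹) 1 := continuousAt_inv₀ one_ne_zero
    have hd2 : ∀ᶠ r : ℝ in 𝓝[<] 1, d < |r⁻¹ - ‖ζ‖| := by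
      refine nhdsWithin_le_nhds (ContinuousAt.eventually_lt (by fun_prop) ?_ ?_)
      · exact (hinv.sub continuousAt_const).abs
      · rw [inv_one, hd]; linarith
    rw [Metric.tendsto_nhds]
    intro ε hε
    -- Chosen so that `3 η / d = ε / (10 π)`; with `hsm`, the integral over `[0, 2π]` is then at
    -- most `2 ε / 5`.
    set η : ℝ := ε * d / (30 * π) with hη
    have hη0 : 0 < η := by positivity
    obtain ⟨r₂, hr₂, hFr₂⟩ := hlim η hη0
    have hgt2 : ∀ᶠ r : ℝ in 𝓝[<] 1, r₂ < r := nhdsWithin_le_nhds (Ioi_mem_nhds hr₂)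
    have hsm : ∀ᶠ r : ℝ in 𝓝[<] 1, 2 * ‖ζ‖ * (r⁻¹ - r) / d ^ 2 < ε / (10 * π) := by
      refine nhdsWithin_le_nhds (ContinuousAt.eventually_lt ?_ (by fun_prop) ?_)
      · exact (continuousAt_const.mul (hinv.sub continuousAt_id)).div_const _
      · rw [inv_one, sub_self, mul_zero, zero_div]; positivity
    filter_upwards [hlt, hgt, hd1, hd2, hgt2, hsm] with r h1 h2 h3 h4 h5 h6
    have hr0 : 0 < r := ha0.trans h2
    have hnr : ∀ θ, ‖circleMap 0 r θ‖ = r := fun θ => by simp [abs_of_pos hr0]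
    have hnr' : ∀ θ, ‖circleMap 0 r⁻¹ θ‖ = r⁻¹ := fun θ => by simp [abs_of_pos hr0]
    have hri : 1 < r⁻¹ := (one_lt_inv₀ hr0).2 h1
    have hri' : r⁻¹ ≤ a⁻¹ := by gcongr
    have hw1 : ∀ θ, d ≤ ‖circleMap 0 r θ - ζ‖ := fun θ => by
      have := abs_norm_sub_norm_le (circleMap 0 r θ) ζ
      rw [hnr] at this; linarith
    have hw2 : ∀ θ, d ≤ ‖circleMap 0 r⁻¹ θ - ζ‖ := fun θ => by
      have := abs_norm_sub_norm_le (circleMap 0 r⁻¹ θ) ζ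
      rw [hnr'] at this; linarith
    have hne1 : ∀ θ, circleMap 0 r θ - ζ ≠ 0 := fun θ h => by
      have := hw1 θ
      rw [h, norm_zero] at this; linarith
    have hne2 : ∀ θ, circleMap 0 r⁻¹ θ - ζ ≠ 0 := fun θ h => by
      have := hw2 θ
      rw [h, norm_zero] at this; linarith
    have hc1 : Continuous fun θ => F (circleMap 0 r θ) := continuous_iff_continuousAt.2 fun θ =>
      ContinuousAt.comp (hFd _ (by rw [hnr]; exact h2.le) (by rwa [hnr])).continuousAt
        (continuous_circleMap 0 r).continuousAt
    have hc2 : Continuous fun θ => Fs (circleMap 0 r⁻¹ θ) := continuous_iff_continuousAt.2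
      fun θ => ContinuousAt.comp (g := Fs)
          (hFsd (circleMap 0 r⁻¹ θ) (by rwa [hnr']) (by rwa [hnr'])).continuousAt
          (continuous_circleMap 0 r⁻¹).continuousAt
    rw [dist_zero_right, circleIntegral, circleIntegral, ← intervalIntegral.integral_sub]
    · have := intervalIntegral.norm_integral_le_of_norm_le_const (a := 0) (b := 2 * π)
        (C := 3 * η / d + ε / (10 * π)) (f := fun θ =>
          deriv (circleMap 0 r) θ • (F (circleMap 0 r θ) / (circleMap 0 r θ - ζ)) -
          deriv (circleMap 0 r⁻¹) θ • (Fs (circleMap 0 r⁻¹ θ) / (circleMap 0 r⁻¹ θ - ζ)))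
        fun θ _ => by
          have hk := norm_reflected_kernel_le (x := F (circleMap 0 r θ)) hd0
            (hlow _ (by rw [hnr]; exact h2.le) (by rwa [hnr]))
            (norm_pos_iff.1 (by rwa [hnr])) (by rw [hnr]; exact h1.le) (hw1 θ)
            (by rw [reflection_circleMap]; exact hw2 θ)
          have hrr : reflection (circleMap 0 r⁻¹ θ) = circleMap 0 r θ := by
            rw [reflection_circleMap, inv_inv]
          rw [reflection_circleMap] at hk
          simp only [deriv_circleMap, smul_eq_mul, hFs, hrr]
          refine hk.trans (add_le_add ?_ ?_)
          · have := hFr₂ (circleMap 0 r θ) (by rwa [hnr]) (by rwa [hnr])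
            gcongr
          · rw [hnr]; exact h6.le
      refine this.trans_lt ?_
      rw [hη, sub_zero, abs_of_pos Real.two_pi_pos]
      have : (3 * (ε * d / (30 * π)) / d + ε / (10 * π)) * (2 * π) = ε * (2 / 5) := by
        field_simp; ring
      rw [this]; linarith
    · refine Continuous.intervalIntegrable ?_ _ _
      simp only [deriv_circleMap, smul_eq_mul]
      exact Continuous.mul (by fun_prop) (hc1.div (by fun_prop) hne1)
    · refine Continuous.intervalIntegrable ?_ _ _
      simp only [deriv_circleMap, smul_eq_mul]
      exact Continuous.mul (by fun_prop) (hc2.div (by fun_prop) hne2)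
  -- Cauchy's formula for `a < |w| < a⁻¹`, with `Fs` on the outer circle and `F` on the inner one;
  -- it is analytic across the unit circle.
  set E : ℂ → ℂ := fun ζ => (2 * π * I)⁻¹ *
    ((∮ w in C(0, a⁻¹), Fs w / (w - ζ)) - ∮ w in C(0, a), F w / (w - ζ)) with hE
  have h2pi : (2 * π * I : ℂ) ≠ 0 := Complex.two_pi_I_ne_zero
  have hai : 1 < a⁻¹ := (one_lt_inv₀ ha0).2 ha2
  have hzero : ∀ (ζ c : ℂ), ‖ζ‖ ≠ 1 → (∀ᶠ r : ℝ in 𝓝[<] 1, (∮ w in C(0, r), F w / (w - ζ)) -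
      (∮ w in C(0, r⁻¹), Fs w / (w - ζ)) = c) → c = 0 := fun ζ c hζ hc =>
    tendsto_nhds_unique (tendsto_const_nhds.congr' (hc.mono fun _ h => h.symm)) (hJ ζ hζ)
  refine ⟨a, E, hqa, ha2, ?_, ?_, ?_⟩
  · intro z h1 h2
    refine DifferentiableAt.const_mul (DifferentiableAt.sub ?_ ?_) _
    · refine differentiableAt_circleIntegral_div_sub (by positivity) (fun w hw => ?_) h2.ne
      have : ‖w‖ = a⁻¹ := by simpa using hw
      exact (hFsd w (by rwa [this]) this.le).continuousAt.continuousWithinAt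
    · refine differentiableAt_circleIntegral_div_sub ha0 (fun w hw => ?_) h1.ne'
      have : ‖w‖ = a := by simpa using hw
      exact (hFd w this.ge (by rwa [this])).continuousAt.continuousWithinAt
  · intro z h1 h2
    -- For every `r` near `1` this difference equals the one in `hJ`; it does not depend on `r`, so
    -- it is the limit `0`.
    have : 2 * π * I * F z - 2 * π * I * E z = 0 := by
      refine hzero z _ h2.ne ?_
      filter_upwards [self_mem_nhdsWithin, nhdsWithin_le_nhds (Ioi_mem_nhds h2)] with r hr1 hr2
      have hr1 : r < 1 := hr1
      have hr2 : ‖z‖ < r := hr2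
      have hr0 : 0 < r := ha0.trans (h1.trans hr2)
      have hri : 1 < r⁻¹ := (one_lt_inv₀ hr0).2 hr1
      have e1 := circleIntegral_annulus_sub (b := r) ha0 h1 hr2 fun w h h' =>
        hFd w h (h'.trans_lt hr1)
      have e2 := circleIntegral_annulus_eq (f := Fs) (ζ := z) (a := r⁻¹) (b := a⁻¹) (by positivity)
        (by gcongr; exact (h1.trans hr2).le) (Or.inl (h2.trans hri))
        fun w h h' => hFsd w (hri.trans_le h) h'
      rw [hE, ← e1, mul_inv_cancel_left₀ h2pi, e2]; ring
    rw [← mul_sub, mul_eq_zero, or_iff_right h2pi, sub_eq_zero] at this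
    exact this.symm
  · intro z h1 h2
    have : 2 * π * I * Fs z - 2 * π * I * E z = 0 := by
      refine hzero z _ h1.ne' ?_
      have hz0 : 0 < ‖z‖ := by linarith
      filter_upwards [self_mem_nhdsWithin, nhdsWithin_le_nhds (Ioi_mem_nhds ha2),
        nhdsWithin_le_nhds (Ioi_mem_nhds (inv_lt_one_of_one_lt₀ h1))] with r hr1 hr2 hr3
      have hr1 : r < 1 := hr1
      have hr2 : a < r := hr2
      have hr0 : 0 < r := ha0.trans hr2
      have hr3 : r⁻¹ < ‖z‖ := by rwa [inv_lt_comm₀ hr0 hz0]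
      have hri : 1 < r⁻¹ := (one_lt_inv₀ hr0).2 hr1
      have e1 := circleIntegral_annulus_sub (f := Fs) (a := r⁻¹) (b := a⁻¹) (by positivity)
        hr3 h2 fun w h h' => hFsd w (hri.trans_le h) h'
      have e2 := circleIntegral_annulus_eq (f := F) (ζ := z) (a := a) (b := r) ha0 hr2.le
        (Or.inr (hr1.trans h1)) fun w h h' => hFd w h (h'.trans_lt hr1)
      rw [hE, ← e1, mul_inv_cancel_left₀ h2pi, e2]; ring
    rw [← mul_sub, mul_eq_zero, or_iff_right h2pi, sub_eq_zero] at this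
    exact this.symm

end ZhukovskyDomain

/-! ### Univalent functions. -/

namespace ZhukovskyDomain

open Complex Metric Set Filter Topology ComplexConjugate

lemma isOpen_image_of_injOn {f : ℂ → ℂ} {G U : Set ℂ} (hU : IsOpen U) (hUG : U ⊆ G)
    (hG : IsOpen G) (hf : DifferentiableOn ℂ f G) (hinj : InjOn f G) : IsOpen (f '' U) := by
  rw [isOpen_iff_mem_nhds]
  rintro _ ⟨z, hz, rfl⟩
  have hGz : G ∈ 𝓝 z := hG.mem_nhds (hUG hz)
  have han : AnalyticAt ℂ f z := hf.analyticAt hGz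
  rcases han.eventually_constant_or_nhds_le_map_nhds with h | h
  · exfalso
    have h1 : ∀ᶠ w in 𝓝 z, w = z := by
      filter_upwards [h, hGz] with w hw hwG using hinj hwG (hUG hz) hw
    have h2 : ∀ᶠ w in 𝓝[≠] z, w = z := nhdsWithin_le_nhds h1
    obtain ⟨w, hw1, hw2⟩ := (h2.and self_mem_nhdsWithin).exists
    exact hw2 hw1
  · exact h (image_mem_map (hU.mem_nhds hz))

section Univalent

variable {f g : ℂ → ℂ} {G B : Set ℂ}

lemma continuousOn_of_invOn (hG : IsOpen G) (hf : DifferentiableOn ℂ f G) (hb : BijOn f G B)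
    (hg : InvOn g f G B) : ContinuousOn g B := by
  have hB : IsOpen B := by
    rw [← hb.image_eq]; exact isOpen_image_of_injOn hG subset_rfl hG hf hb.injOn
  have hgm : MapsTo g B G := by
    intro y hy
    obtain ⟨x, hx, rfl⟩ := hb.surjOn hy
    rwa [hg.1 hx]
  intro y hy
  refine ContinuousAt.continuousWithinAt ?_
  rw [ContinuousAt, tendsto_def]
  intro s hs
  obtain ⟨U, hUs, hUo, hyU⟩ := _root_.mem_nhds_iff.1 hs
  have ho := isOpen_image_of_injOn (hUo.inter hG) inter_subset_right hG hf hb.injOn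
  refine mem_of_superset (ho.mem_nhds ⟨g y, ⟨hyU, hgm hy⟩, hg.2 hy⟩) ?_
  rintro _ ⟨x, ⟨hxU, hxG⟩, rfl⟩
  rw [mem_preimage, hg.1 hxG]
  exact hUs hxU

/-- The derivative of a univalent function has no zeros. -/
theorem deriv_ne_zero_of_injOn (hG : IsOpen G) (hf : DifferentiableOn ℂ f G) (hinj : InjOn f G)
    {z : ℂ} (hz : z ∈ G) : deriv f z ≠ 0 := by
  classical
  set B := f '' G with hB'
  have hb : BijOn f G B := hinj.bijOn_image
  set g := Function.invFunOn f G with hg'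
  have hg : InvOn g f G B := hb.invOn_invFunOn
  have hB : IsOpen B := isOpen_image_of_injOn hG subset_rfl hG hf hinj
  have hgm : MapsTo g B G := by
    intro y hy
    obtain ⟨x, hx, rfl⟩ := hb.surjOn hy
    rwa [hg.1 hx]
  have hgc : ContinuousOn g B := continuousOn_of_invOn hG hf hb hg
  have hfB : f z ∈ B := mem_image_of_mem f hz
  have hgca : ∀ y ∈ B, ContinuousAt g y := fun y hy => hgc.continuousAt (hB.mem_nhds hy)
  have hfa : AnalyticAt ℂ f z := hf.analyticAt (hG.mem_nhds hz)
  -- Critical points are isolated: otherwise `f` would be constant on a disk.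
  have hnc : ∀ᶠ w in 𝓝[≠] z, deriv f w ≠ 0 := by
    rcases hfa.deriv.eventually_eq_zero_or_eventually_ne_zero with h | h
    · exfalso
      obtain ⟨r, hr, hball⟩ := Metric.eventually_nhds_iff_ball.1 (h.and (hG.mem_nhds hz))
      have hz' : z + (r / 2 : ℝ) ∈ ball z r := by
        simp [dist_eq_norm, abs_of_pos hr, hr]
      have hc := (convex_ball z r).is_const_of_fderivWithin_eq_zero (𝕜 := ℂ) (f := f)
        (fun w hw => (hf.differentiableAt (hG.mem_nhds (hball w hw).2)).differentiableWithinAt)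
        (fun w hw => by
          rw [fderivWithin_of_isOpen isOpen_ball hw]
          ext
          simpa using (hball w hw).1)
        hz' (mem_ball_self hr)
      have := hinj (hball _ hz').2 hz hc
      simp [hr.ne'] at this
    · exact h
  have hgt : Tendsto g (𝓝[≠] (f z)) (𝓝[≠] z) := by
    refine tendsto_nhdsWithin_of_tendsto_nhds_of_eventually_within _ ?_ ?_
    · have := (hgca _ hfB).tendsto
      rw [hg.1 hz] at this
      exact this.mono_left nhdsWithin_le_nhds
    · filter_upwards [self_mem_nhdsWithin, nhdsWithin_le_nhds (hB.mem_nhds hfB)] with y hy hyB h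
      rw [mem_singleton_iff] at h
      exact hy (by rw [mem_singleton_iff, ← h, hg.2 hyB])
  have hgd : ∀ᶠ y in 𝓝[≠] (f z), DifferentiableAt ℂ g y := by
    filter_upwards [hgt.eventually hnc, nhdsWithin_le_nhds (hB.mem_nhds hfB)] with y hy hyB
    have h1 : HasDerivAt f (deriv f (g y)) (g y) :=
      (hf.differentiableAt (hG.mem_nhds (hgm hyB))).hasDerivAt
    refine (h1.of_local_left_inverse (hgca y hyB) hy ?_).differentiableAt
    filter_upwards [hB.mem_nhds hyB] with x hx using hg.2 hx
  -- The inverse has a removable singularity at `f z`; the chain rule for `g ∘ f = id` then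
  -- contradicts `f'(z) = 0`.
  have hga : AnalyticAt ℂ g (f z) :=
    analyticAt_of_differentiable_on_punctured_nhds_of_continuousAt hgd (hgca _ hfB)
  intro h0
  have h1 : HasDerivAt (g ∘ f) (deriv g (f z) * deriv f z) z :=
    hga.differentiableAt.hasDerivAt.comp z hfa.differentiableAt.hasDerivAt
  have h2 : HasDerivAt (g ∘ f) 1 z := (hasDerivAt_id z).congr_of_eventuallyEq (by
    filter_upwards [hG.mem_nhds hz] with w hw using hg.1 hw)
  have := h1.unique h2
  rw [h0, mul_zero] at this
  exact zero_ne_one this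

/-- A conformal map onto the unit disk has modulus close to `1` off a compact set. -/
lemma exists_isCompact_norm_lt (hG : IsOpen G) (hf : DifferentiableOn ℂ f G)
    (hb : BijOn f G (ball 0 1)) {r : ℝ} (hr : r < 1) :
    ∃ K ⊆ G, IsCompact K ∧ ∀ z ∈ G, z ∉ K → r < ‖f z‖ := by
  set g := Function.invFunOn f G
  have hg : InvOn g f G (ball 0 1) := hb.invOn_invFunOn
  have hsub : closedBall (0 : ℂ) r ⊆ ball 0 1 := closedBall_subset_ball hr
  refine ⟨g '' closedBall 0 r, ?_, ?_, ?_⟩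
  · rintro _ ⟨y, hy, rfl⟩
    obtain ⟨x, hx, rfl⟩ := hb.surjOn (hsub hy)
    rwa [hg.1 hx]
  · exact (isCompact_closedBall 0 r).image_of_continuousOn
      ((continuousOn_of_invOn hG hf hb hg).mono hsub)
  · intro z hz hzK
    by_contra! h
    exact hzK ⟨f z, by simpa using h, hg.1 hz⟩

end Univalent

end ZhukovskyDomain

/-! ### Connectedness of annuli and components of a complement. -/

namespace ZhukovskyDomain

open Complex Metric Set Filter Topology ComplexConjugate

section Connectedness

lemma image_polar (S : Set ℝ) (hS : ∀ r ∈ S, 0 ≤ r) :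
    (fun p : ℝ × ℝ => (p.1 : ℂ) * exp (p.2 * I)) '' (S ×ˢ univ) = {w | ‖w‖ ∈ S} := by
  ext w
  constructor
  · rintro ⟨⟨r, θ⟩, ⟨hr, -⟩, rfl⟩
    simp only [mem_ofPred_eq, norm_mul, norm_real, norm_exp_ofReal_mul_I, mul_one,
      Real.norm_of_nonneg (hS r hr)]
    exact hr
  · intro hw
    exact ⟨(‖w‖, arg w), ⟨hw, mem_univ _⟩, norm_mul_exp_arg_mul_I w⟩

lemma isPreconnected_setOf_norm_mem {S : Set ℝ} (hS : ∀ r ∈ S, 0 ≤ r) (hc : IsPreconnected S) :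
    IsPreconnected {w : ℂ | ‖w‖ ∈ S} := by
  rw [← image_polar S hS]
  exact (hc.prod isPreconnected_univ).image _ (by fun_prop)

lemma isPreconnected_outside {r : ℝ} (hr : 0 ≤ r) : IsPreconnected (outside r) :=
  isPreconnected_setOf_norm_mem (S := Ioi r) (fun _ h => hr.trans (le_of_lt h)) isPreconnected_Ioi

lemma isPreconnected_annulus {r s : ℝ} (hr : 0 ≤ r) : IsPreconnected (annulus r s) :=
  isPreconnected_setOf_norm_mem (S := Ioo r s) (fun _ h => hr.trans h.1.le) isPreconnected_Ioo

lemma isOpen_outside (r : ℝ) : IsOpen (outside r) := isOpen_lt continuous_const continuous_norm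

lemma isOpen_annulus (r s : ℝ) : IsOpen (annulus r s) :=
  (isOpen_lt continuous_const continuous_norm).inter (isOpen_lt continuous_norm continuous_const)

lemma connectedComponentIn_eq_of_separation {U V C : Set ℂ} (hU : IsOpen U) (hV : IsOpen V)
    (hUV : Disjoint U V) (hC : U ∪ V = C) (hc : IsPreconnected U) {z : ℂ} (hz : z ∈ U) :
    connectedComponentIn C z = U := by
  subst hC
  refine subset_antisymm ?_ (hc.subset_connectedComponentIn hz subset_union_left)
  exact isPreconnected_connectedComponentIn.subset_left_of_subset_union hU hV hUV
    (connectedComponentIn_subset _ _) ⟨z, mem_connectedComponentIn (Or.inl hz), hz⟩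

end Connectedness

/-! ### The map `psi`: its fibres, the complement of the curve, the radius of univalence. -/

section Psi

variable {R : ℝ}

lemma exists_one_le_norm_add_inv (z : ℂ) : ∃ u : ℂ, 1 ≤ ‖u‖ ∧ u + u⁻¹ = z := by
  obtain ⟨s, hs⟩ := IsAlgClosed.exists_pow_nat_eq (z ^ 2 - 4) (n := 2) (by norm_num)
  have hp : (z + s) / 2 * ((z - s) / 2) = 1 := by linear_combination (-1 / 4) * hs
  have h1 : (z + s) / 2 ≠ 0 := left_ne_zero_of_mul_eq_one hp
  have h2 : (z - s) / 2 ≠ 0 := right_ne_zero_of_mul_eq_one hp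
  have e1 : ((z + s) / 2)⁻¹ = (z - s) / 2 := inv_eq_of_mul_eq_one_right hp
  have e2 : ((z - s) / 2)⁻¹ = (z + s) / 2 := inv_eq_of_mul_eq_one_left hp
  rcases le_total 1 ‖(z + s) / 2‖ with h | h
  · exact ⟨_, h, by rw [e1]; ring⟩
  · refine ⟨(z - s) / 2, ?_, by rw [e2]; ring⟩
    rw [← e1, norm_inv]
    exact (one_le_inv₀ (norm_pos_iff.2 h1)).2 h

lemma add_inv_eq_add_inv {u v : ℂ} (hu : u ≠ 0) (hv : v ≠ 0) (h : u + u⁻¹ = v + v⁻¹) :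
    u = v ∨ u * v = 1 := by
  have : (u - v) * (u * v - 1) = 0 := by
    field_simp at h
    linear_combination h
  rcases mul_eq_zero.1 this with h | h
  · exact Or.inl (sub_eq_zero.1 h)
  · exact Or.inr (sub_eq_zero.1 h)

lemma norm_le_of_one_le (hR : 2 < R) {w : ℂ} (hw : 1 ≤ ‖w‖) : ‖w‖ < ‖R * w - 1‖ := by
  have h := norm_sub_norm_le ((R : ℂ) * w) 1
  rw [norm_mul, norm_real, Real.norm_of_nonneg (by linarith), norm_one] at h
  nlinarith

lemma mul_sub_one_ne_zero (hR : 2 < R) {w : ℂ} (hw : 1 ≤ ‖w‖) : (R * w - 1 : ℂ) ≠ 0 :=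
  norm_pos_iff.1 (by linarith [norm_le_of_one_le hR hw])

lemma psi_eq_psi (hR : 2 < R) {w w' : ℂ} (hw : (R * w - 1 : ℂ) ≠ 0) (hw' : (R * w' - 1 : ℂ) ≠ 0)
    (h : psi R w = psi R w') : w = w' ∨ (R * w - 1) * (R * w' - 1) = (1 : ℂ) := by
  have hR0 : (R : ℂ) ≠ 0 := by exact_mod_cast (by linarith : R ≠ 0)
  rcases add_inv_eq_add_inv hw hw' h with h | h
  · exact Or.inl (mul_left_cancel₀ hR0 (sub_left_injective h))
  · exact Or.inr h

/-- The set of the `w` in the unit disk whose image under `psi R` lies inside the curve. -/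
def innerPreimage (R : ℝ) : Set ℂ := {w | ‖w‖ < 1 ∧ ‖w‖ < ‖R * w - 1‖}

lemma mul_sub_one_ne_zero_of_mem {w : ℂ} (hw : w ∈ innerPreimage R) : (R * w - 1 : ℂ) ≠ 0 :=
  norm_pos_iff.1 ((norm_nonneg _).trans_lt hw.2)

/-- The other preimage satisfies `w' = w (R w' - 1)`, so `1 ≤ |w|` gives `|R w' - 1| ≤ |w'|`. -/
lemma not_mem_innerPreimage_of_psi_eq (hR : 2 < R) {w w' : ℂ} (hw : 1 ≤ ‖w‖)
    (h : psi R w = psi R w') : w' ∉ innerPreimage R := by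
  intro hw'
  rcases psi_eq_psi hR (mul_sub_one_ne_zero hR hw) (mul_sub_one_ne_zero_of_mem hw') h with h | h
  · subst h; exact absurd hw'.1 (not_lt.2 hw)
  · have h0 : (R : ℂ) ≠ 0 := by exact_mod_cast (by linarith : R ≠ 0)
    have e : w' = w * (R * w' - 1) := by
      have : (R : ℂ) * w' = R * (w * (R * w' - 1)) := by linear_combination -h
      exact mul_left_cancel₀ h0 this
    have h1 : ‖w'‖ = ‖w‖ * ‖R * w' - 1‖ := by rw [← norm_mul, ← e]
    have h2 := hw'.2
    nlinarith [norm_nonneg (R * w' - 1 : ℂ)]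

/-- Beyond `|w| = 2 / R` one has `|R w - 1| > 1`, so two such factors cannot have product `1`. -/
lemma psi_injOn (hR : 2 < R) : InjOn (psi R) (outside (2 / R)) := by
  have hR0 : 0 < R := by linarith
  have hlt : ∀ w ∈ outside (2 / R), 1 < ‖R * w - 1‖ := by
    intro w hw
    have hw : 2 / R < ‖w‖ := hw
    rw [div_lt_iff₀ hR0] at hw
    have h := norm_sub_norm_le ((R : ℂ) * w) 1
    rw [norm_mul, norm_real, Real.norm_of_nonneg hR0.le, norm_one] at h
    linarith
  intro w hw w' hw' h
  have h1 := hlt w hw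
  have h2 := hlt w' hw'
  rcases psi_eq_psi hR (norm_pos_iff.1 (by linarith)) (norm_pos_iff.1 (by linarith)) h with h | h
  · exact h
  · have := congrArg norm h
    rw [norm_mul, norm_one] at this
    nlinarith

lemma two_div_lt_one (hR : 2 < R) : 2 / R < 1 := by rw [div_lt_one (by linarith)]; exact hR

lemma outside_subset {r s : ℝ} (h : r ≤ s) : outside s ⊆ outside r := fun _ hw => h.trans_lt hw

lemma hasDerivAt_psi {w : ℂ} (hw : (R * w - 1 : ℂ) ≠ 0) :
    HasDerivAt (psi R) (R - R / (R * w - 1) ^ 2) w := by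
  have h1 : HasDerivAt (fun w : ℂ => (R * w - 1 : ℂ)) R w := by
    simpa using ((hasDerivAt_id w).const_mul (R : ℂ)).sub_const 1
  exact (h1.add (h1.fun_inv hw)).congr_deriv (by ring)

lemma mul_sub_one_ne_zero_of_outside (hR : 2 < R) {w : ℂ} (hw : w ∈ outside (1 / R)) :
    (R * w - 1 : ℂ) ≠ 0 := by
  intro h
  have hw : 1 / R < ‖w‖ := hw
  have h1 : ‖(R * w : ℂ)‖ = 1 := by rw [sub_eq_zero.1 h, norm_one]
  rw [norm_mul, norm_real, Real.norm_of_nonneg (by linarith)] at h1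
  rw [div_lt_iff₀ (by linarith)] at hw
  linarith

lemma differentiableOn_psi (hR : 2 < R) : DifferentiableOn ℂ (psi R) (outside (1 / R)) :=
  fun _ hw => (hasDerivAt_psi
    (mul_sub_one_ne_zero_of_outside hR hw)).differentiableAt.differentiableWithinAt

lemma curve_eq (hR : 2 < R) : curve R = psi R '' {w | ‖w‖ = 1} := by
  have hR0 : (R : ℂ) ≠ 0 := by exact_mod_cast (by linarith : R ≠ 0)
  ext z
  constructor
  · rintro ⟨w, hw, rfl⟩
    refine ⟨w / R, ?_, ?_⟩
    · rw [mem_ofPred_eq, norm_div, hw, norm_real, Real.norm_of_nonneg (by linarith),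
        div_self (by linarith)]
    · rw [psi, mul_div_cancel₀ _ hR0]
  · rintro ⟨w, hw, rfl⟩
    refine ⟨R * w, ?_, rfl⟩
    rw [norm_mul, hw, norm_real, Real.norm_of_nonneg (by linarith), mul_one]

lemma exists_psi_eq (hR : 2 < R) (z : ℂ) : ∃ w : ℂ, 1 ≤ ‖R * w - 1‖ ∧ psi R w = z := by
  have hR0 : (R : ℂ) ≠ 0 := by exact_mod_cast (by linarith : R ≠ 0)
  obtain ⟨u, hu, rfl⟩ := exists_one_le_norm_add_inv z
  have : (R * ((u + 1) / R) - 1 : ℂ) = u := by field_simp; ring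
  exact ⟨(u + 1) / R, by rwa [this], by rw [psi, this]⟩

lemma disjoint_curve_inner (hR : 2 < R) : Disjoint (curve R) (psi R '' innerPreimage R) := by
  rw [curve_eq hR, disjoint_left]
  rintro _ ⟨w, hw, rfl⟩ ⟨w', hw', h⟩
  exact not_mem_innerPreimage_of_psi_eq hR (le_of_eq (Eq.symm hw)) h.symm hw'

lemma disjoint_inner_outer (hR : 2 < R) :
    Disjoint (psi R '' innerPreimage R) (psi R '' outside 1) := by
  rw [disjoint_left]
  rintro _ ⟨w', hw', rfl⟩ ⟨w, hw, h⟩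
  exact not_mem_innerPreimage_of_psi_eq hR (le_of_lt hw) h hw'

lemma disjoint_curve_outer (hR : 2 < R) : Disjoint (curve R) (psi R '' outside 1) := by
  rw [curve_eq hR, disjoint_left]
  rintro _ ⟨w, hw, rfl⟩ ⟨w', hw', h⟩
  have hw1 : ‖w‖ = 1 := hw
  have hw2 : 1 < ‖w'‖ := hw'
  have h2 := two_div_lt_one hR
  have := psi_injOn hR (show 2 / R < ‖w'‖ by linarith) (show 2 / R < ‖w‖ by linarith) h
  rw [this] at hw2; linarith

/-- Of the two preimages, take one with `1 ≤ |R w - 1|`; then `|w| < 1` alone puts it in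
`innerPreimage R`. -/
lemma compl_curve (hR : 2 < R) :
    psi R '' innerPreimage R ∪ psi R '' outside 1 = (curve R)ᶜ := by
  ext z
  constructor
  · rintro (h | h) hz
    · exact disjoint_left.1 (disjoint_curve_inner hR) hz h
    · exact disjoint_left.1 (disjoint_curve_outer hR) hz h
  · intro hz
    obtain ⟨w, hw, rfl⟩ := exists_psi_eq hR z
    rcases lt_trichotomy ‖w‖ 1 with h | h | h
    · exact Or.inl ⟨w, ⟨h, h.trans_le hw⟩, rfl⟩
    · exact absurd (by rw [curve_eq hR]; exact ⟨w, h, rfl⟩) hz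
    · exact Or.inr ⟨w, h, rfl⟩

lemma tendsto_psi_div (hR : 2 < R) :
    Tendsto (fun w => psi R w / w) (Bornology.cobounded ℂ) (𝓝 (R : ℂ)) := by
  have hR0 : (R : ℂ) ≠ 0 := by exact_mod_cast (by linarith : R ≠ 0)
  have h1 : Tendsto (fun x : ℂ => R - x + x ^ 2 * (R - x)⁻¹) (𝓝 0) (𝓝 R) := by
    have : ContinuousAt (fun x : ℂ => R - x + x ^ 2 * (R - x)⁻¹) 0 := by
      refine ContinuousAt.add (by fun_prop) (ContinuousAt.mul (by fun_prop) ?_)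
      exact ContinuousAt.inv₀ (by fun_prop) (by simpa using hR0)
    simpa using this.tendsto
  refine (h1.comp tendsto_inv₀_cobounded).congr' ?_
  filter_upwards [Bornology.eventually_ne_cobounded (0 : ℂ)] with w hw
  have : (R - w⁻¹ : ℂ) = (R * w - 1) / w := by field_simp
  simp only [Function.comp_apply, psi]
  rw [this, inv_div]
  field_simp

/-- The obstruction is the critical point `w = 2 / R`, where `u = 1`: the derivative of a univalent
function has no zeros. -/
lemma rho_psi (hR : 2 < R) : rho (psi R) = 2 / R := by
  have hR0 : 0 < R := by linarith
  have h12 : 1 / R < 2 / R := by gcongr; norm_num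
  refine IsLeast.csInf_eq ⟨⟨by positivity, two_div_lt_one hR, psi R,
    (differentiableOn_psi hR).mono (outside_subset h12.le), psi_injOn hR, fun _ _ => rfl⟩, ?_⟩
  rintro r ⟨hr0, hr1, g, hg, hinj, heq⟩
  by_contra! hlt
  -- The pole of `psi R` is at `1 / R`; on `|w| > s` both functions are analytic and the identity
  -- theorem applies.
  set s := max r (1 / R)
  have hs0 : 0 ≤ s := hr0.trans (le_max_left _ _)
  have hs : s < 2 / R := max_lt hlt h12
  have hs1 : s < 1 := hs.trans (two_div_lt_one hR)
  have hgd : DifferentiableOn ℂ g (outside s) := hg.mono (outside_subset (le_max_left _ _))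
  have hpd : DifferentiableOn ℂ (psi R) (outside s) :=
    (differentiableOn_psi hR).mono (outside_subset (le_max_right _ _))
  have h2 : (2 : ℂ) ∈ outside 1 := by simp [outside]
  have hE : EqOn g (psi R) (outside s) :=
    (hgd.analyticOnNhd (isOpen_outside s)).eqOn_of_preconnected_of_eventuallyEq
      (hpd.analyticOnNhd (isOpen_outside s)) (isPreconnected_outside hs0)
      (outside_subset hs1.le h2) (heq.eventuallyEq_of_mem ((isOpen_outside 1).mem_nhds h2))
  have hi : InjOn (psi R) (outside s) :=
    (hinj.mono (outside_subset (le_max_left _ _))).congr hE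
  have hmem : ((2 / R : ℝ) : ℂ) ∈ outside s := by
    simp only [outside, mem_ofPred_eq, norm_real]
    rwa [Real.norm_of_nonneg (by positivity)]
  refine deriv_ne_zero_of_injOn (isOpen_outside s) hpd hi hmem ?_
  have hu : (R * ((2 / R : ℝ) : ℂ) - 1 : ℂ) = 1 := by
    have : (R : ℂ) ≠ 0 := by exact_mod_cast hR0.ne'
    push_cast; field_simp; ring
  rw [(hasDerivAt_psi (by rw [hu]; exact one_ne_zero)).deriv, hu]
  simp

end Psi

end ZhukovskyDomain

/-! ### The annulus coordinate, and the two domains of the curve. -/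

namespace ZhukovskyDomain

open Complex Metric Set Filter Topology ComplexConjugate

/-- The automorphism of the unit disk that maps `0` to `μ`. -/
noncomputable def diskMap (μ : ℝ) (t : ℂ) : ℂ := (t + μ) / (1 + μ * t)

/-- The inverse of `diskMap μ`. -/
noncomputable def diskInv (μ : ℝ) (w : ℂ) : ℂ := (w - μ) / (1 - μ * w)

section Annulus

variable {μ R : ℝ}

lemma norm_affine_sq (a b : ℝ) (t : ℂ) :
    ‖(a * t + b : ℂ)‖ ^ 2 = a ^ 2 * ‖t‖ ^ 2 + 2 * a * b * t.re + b ^ 2 := by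
  rw [Complex.sq_norm, Complex.sq_norm, normSq_apply, normSq_apply]
  simp
  ring

lemma ne_zero_of_norm_lt {a t : ℂ} (h : ‖a‖ < ‖t‖) : t + a ≠ 0 := by
  intro h0
  rw [eq_neg_of_add_eq_zero_left h0, norm_neg] at h
  exact lt_irrefl _ h

lemma one_add_mul_ne_zero (h0 : 0 < μ) {t : ℂ} (ht : μ * ‖t‖ < 1) : (1 + μ * t : ℂ) ≠ 0 := by
  refine ne_zero_of_norm_lt ?_
  rwa [norm_mul, norm_real, Real.norm_of_nonneg h0.le, norm_one]

lemma one_sub_mul_ne_zero (h0 : 0 < μ) {t : ℂ} (ht : μ * ‖t‖ < 1) : (1 - μ * t : ℂ) ≠ 0 := by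
  have := one_add_mul_ne_zero (t := -t) h0 (by rwa [norm_neg])
  rwa [mul_neg, ← sub_eq_add_neg] at this

lemma norm_diskMap_sq_sub_one {t : ℂ} (ht : (1 + μ * t : ℂ) ≠ 0) :
    (‖diskMap μ t‖ ^ 2 - 1) * ‖(1 + μ * t : ℂ)‖ ^ 2 = (1 - μ ^ 2) * (‖t‖ ^ 2 - 1) := by
  have h1 := norm_affine_sq 1 μ t
  have h2 := norm_affine_sq μ 1 t
  rw [ofReal_one, one_mul] at h1
  rw [ofReal_one, add_comm] at h2
  have h3 : ‖diskMap μ t‖ ^ 2 * ‖(1 + μ * t : ℂ)‖ ^ 2 = ‖t + μ‖ ^ 2 := by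
    rw [← mul_pow, ← norm_mul, diskMap, div_mul_cancel₀ _ ht]
  rw [sub_mul, h3, h1, h2]; ring

lemma norm_diskMap_lt_one_iff (h0 : 0 < μ) (h1 : μ < 1) {t : ℂ} (ht : (1 + μ * t : ℂ) ≠ 0) :
    ‖diskMap μ t‖ < 1 ↔ ‖t‖ < 1 := by
  have h := norm_diskMap_sq_sub_one ht
  have hp : 0 < ‖(1 + μ * t : ℂ)‖ ^ 2 := by positivity
  have hm : 0 < 1 - μ ^ 2 := by nlinarith
  rw [← sq_lt_one_iff₀ (norm_nonneg _), ← sq_lt_one_iff₀ (norm_nonneg t), ← sub_neg,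
    ← sub_neg (a := ‖t‖ ^ 2)]
  constructor
  · intro hl; nlinarith
  · intro hl; nlinarith

lemma norm_diskMap_eq_one (h1 : μ < 1) (h0 : 0 < μ) {t : ℂ} (ht : ‖t‖ = 1) :
    ‖diskMap μ t‖ = 1 := by
  have hne : (1 + μ * t : ℂ) ≠ 0 := one_add_mul_ne_zero h0 (by rw [ht]; linarith)
  have h := norm_diskMap_sq_sub_one hne
  rw [ht, one_pow, sub_self, mul_zero, mul_eq_zero, or_iff_left (by positivity), sub_eq_zero,
    pow_eq_one_iff_of_nonneg (norm_nonneg _) two_ne_zero] at h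
  exact h

lemma one_add_mul_diskInv_ne_zero (h0 : 0 < μ) (h1 : μ < 1) {w : ℂ} (hw : (1 - μ * w : ℂ) ≠ 0) :
    (1 + μ * diskInv μ w : ℂ) ≠ 0 := by
  have : (1 + μ * diskInv μ w : ℂ) = ((1 - μ ^ 2 : ℝ) : ℂ) / (1 - μ * w) := by
    rw [diskInv]; push_cast; field_simp; ring
  rw [this]
  refine div_ne_zero ?_ hw
  have : 1 - μ ^ 2 ≠ 0 := by nlinarith
  exact_mod_cast this

lemma diskMap_diskInv (h0 : 0 < μ) (h1 : μ < 1) {w : ℂ} (hw : (1 - μ * w : ℂ) ≠ 0) :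
    diskMap μ (diskInv μ w) = w := by
  have h : diskInv μ w * (1 - μ * w) = w - μ := div_mul_cancel₀ _ hw
  rw [diskMap, div_eq_iff (one_add_mul_diskInv_ne_zero h0 h1 hw)]
  linear_combination h

lemma diskInv_diskMap (h0 : 0 < μ) (h1 : μ < 1) {t : ℂ} (ht : (1 + μ * t : ℂ) ≠ 0) :
    diskInv μ (diskMap μ t) = t := by
  have h2 : (1 - μ * diskMap μ t : ℂ) ≠ 0 := by
    have : (1 - μ * diskMap μ t : ℂ) = ((1 - μ ^ 2 : ℝ) : ℂ) / (1 + μ * t) := by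
      rw [diskMap]; push_cast; field_simp; ring
    rw [this]
    refine div_ne_zero ?_ ht
    have : 1 - μ ^ 2 ≠ 0 := by nlinarith
    exact_mod_cast this
  have h : diskMap μ t * (1 + μ * t) = t + μ := div_mul_cancel₀ _ ht
  rw [diskInv, div_eq_iff h2]
  linear_combination h

lemma mul_diskMap_sub_one (h0 : 0 < μ) (hR : R = μ + μ⁻¹) {t : ℂ} (ht : (1 + μ * t : ℂ) ≠ 0) :
    (R * diskMap μ t - 1 : ℂ) = (t + (μ : ℂ) ^ 3) / (μ * (1 + μ * t)) := by
  have hμ : (μ : ℂ) ≠ 0 := by exact_mod_cast h0.ne'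
  rw [hR, diskMap]; push_cast
  field_simp; ring

/-- The map `x ↦ (R - x)⁻¹` fixes `μ` and `μ⁻¹`, which `diskMap μ` places over `0` and `∞`; hence it
is a scaling in `t`. -/
lemma diskMap_sq_mul (h0 : 0 < μ) (hR : R = μ + μ⁻¹) {t : ℂ} (ht : (1 + μ * t : ℂ) ≠ 0) :
    diskMap μ ((μ : ℂ) ^ 2 * t) = (R - diskMap μ t)⁻¹ := by
  have hμ : (μ : ℂ) ≠ 0 := by exact_mod_cast h0.ne'
  have e : (R - diskMap μ t : ℂ) = (1 + μ * (μ ^ 2 * t)) / (μ * (1 + μ * t)) := by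
    rw [hR, diskMap]; push_cast
    field_simp; ring
  rw [e, inv_div, diskMap]
  congr 1; ring

lemma two_lt_of_eq (h0 : 0 < μ) (h1 : μ < 1) (hR : R = μ + μ⁻¹) : 2 < R := by
  have h2 : μ * μ⁻¹ = 1 := mul_inv_cancel₀ h0.ne'
  have h3 : 1 < μ⁻¹ := (one_lt_inv₀ h0).2 h1
  nlinarith

lemma cube_lt_sq (h0 : 0 < μ) (h1 : μ < 1) : μ ^ 3 < μ ^ 2 :=
  pow_lt_pow_right_of_lt_one₀ h0 h1 (by norm_num)

lemma add_cube_ne_zero (h0 : 0 < μ) (h1 : μ < 1) {t : ℂ} (ht : μ ^ 2 ≤ ‖t‖) :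
    t + (μ : ℂ) ^ 3 ≠ 0 := by
  refine ne_zero_of_norm_lt ?_
  rw [norm_pow, norm_real, Real.norm_of_nonneg h0.le]
  exact (cube_lt_sq h0 h1).trans_le ht

/-- The second inequality becomes `μ |t + μ| < |t + μ³|`. After squaring, the terms in `t.re` cancel
and `(1 - μ²)(|t|² - μ⁴) > 0` remains: this choice of `μ` makes both boundary circles concentric. -/
lemma diskMap_mem_innerPreimage_iff (h0 : 0 < μ) (h1 : μ < 1) (hR : R = μ + μ⁻¹) {t : ℂ}
    (ht : (1 + μ * t : ℂ) ≠ 0) : diskMap μ t ∈ innerPreimage R ↔ t ∈ annulus (μ ^ 2) 1 := by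
  have hm : 0 < 1 - μ ^ 2 := by nlinarith
  have hp : 0 < ‖(1 + μ * t : ℂ)‖ := by positivity
  have key : ‖diskMap μ t‖ < ‖(R * diskMap μ t - 1 : ℂ)‖ ↔ μ ^ 2 < ‖t‖ := by
    rw [mul_diskMap_sub_one h0 hR ht, diskMap, norm_div, norm_div, norm_mul, norm_real,
      Real.norm_of_nonneg h0.le, div_lt_div_iff₀ hp (by positivity), ← mul_assoc,
      mul_lt_mul_iff_left₀ hp]
    have e1 := norm_affine_sq 1 μ t
    have e2 := norm_affine_sq 1 (μ ^ 3) t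
    rw [ofReal_one, one_mul] at e1
    rw [ofReal_one, one_mul, ofReal_pow] at e2
    rw [← sq_lt_sq₀ (by positivity) (norm_nonneg _), mul_pow, e1, e2,
      ← sq_lt_sq₀ (by positivity) (norm_nonneg t), ← sub_pos, ← sub_pos (a := ‖t‖ ^ 2)]
    have : 1 ^ 2 * ‖t‖ ^ 2 + 2 * 1 * μ ^ 3 * t.re + (μ ^ 3) ^ 2 -
        (1 ^ 2 * ‖t‖ ^ 2 + 2 * 1 * μ * t.re + μ ^ 2) * μ ^ 2 =
        (1 - μ ^ 2) * (‖t‖ ^ 2 - (μ ^ 2) ^ 2) := by ring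
    rw [this, mul_pos_iff_of_pos_left hm]
  exact ⟨fun h => ⟨key.1 h.2, (norm_diskMap_lt_one_iff h0 h1 ht).1 h.1⟩,
    fun h => ⟨(norm_diskMap_lt_one_iff h0 h1 ht).2 h.2, key.2 h.1⟩⟩

lemma innerPreimage_eq (h0 : 0 < μ) (h1 : μ < 1) (hR : R = μ + μ⁻¹) :
    innerPreimage R = diskMap μ '' annulus (μ ^ 2) 1 := by
  ext w
  constructor
  · intro hw
    have hw1 : ‖w‖ < 1 := hw.1
    have h2 : (1 - μ * w : ℂ) ≠ 0 := one_sub_mul_ne_zero h0 (by nlinarith [norm_nonneg w])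
    have h3 := one_add_mul_diskInv_ne_zero h0 h1 h2
    have h4 := diskMap_diskInv h0 h1 h2
    refine ⟨diskInv μ w, ?_, h4⟩
    rw [← diskMap_mem_innerPreimage_iff h0 h1 hR h3, h4]
    exact hw
  · rintro ⟨t, ht, rfl⟩
    have ht1 : ‖t‖ < 1 := ht.2
    refine (diskMap_mem_innerPreimage_iff h0 h1 hR (one_add_mul_ne_zero h0 ?_)).2 ht
    nlinarith [norm_nonneg t]

/-- The map `psi` in the coordinate of `diskMap`. -/
noncomputable def annulusMap (μ R : ℝ) (t : ℂ) : ℂ := psi R (diskMap μ t)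

/-- The substitution `t ↦ μ² / t` sends `u` to `u⁻¹`. -/
lemma annulusMap_sq_div (h0 : 0 < μ) (h1 : μ < 1) (hR : R = μ + μ⁻¹) {t : ℂ}
    (ht : μ ^ 2 ≤ ‖t‖) (ht1 : ‖t‖ ≤ 1) :
    annulusMap μ R ((μ : ℂ) ^ 2 / t) = annulusMap μ R t := by
  have hμ : (μ : ℂ) ≠ 0 := by exact_mod_cast h0.ne'
  have htp : 0 < ‖t‖ := lt_of_lt_of_le (by positivity) ht
  have ht0 : t ≠ 0 := norm_pos_iff.1 htp
  have e1 : (1 + μ * t : ℂ) ≠ 0 := one_add_mul_ne_zero h0 (by nlinarith)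
  have e2 := add_cube_ne_zero h0 h1 ht
  have e3 : (1 + μ * ((μ : ℂ) ^ 2 / t) : ℂ) = (t + (μ : ℂ) ^ 3) / t := by field_simp
  have e4 : (1 + μ * ((μ : ℂ) ^ 2 / t) : ℂ) ≠ 0 := by rw [e3]; exact div_ne_zero e2 ht0
  have e5 : (R * diskMap μ ((μ : ℂ) ^ 2 / t) - 1 : ℂ) = (R * diskMap μ t - 1 : ℂ)⁻¹ := by
    rw [mul_diskMap_sub_one h0 hR e1, mul_diskMap_sub_one h0 hR e4, e3]
    field_simp
  rw [annulusMap, annulusMap, psi, psi, e5, inv_inv, add_comm]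

lemma differentiableAt_diskMap {t : ℂ} (ht : (1 + μ * t : ℂ) ≠ 0) :
    DifferentiableAt ℂ (diskMap μ) t :=
  DifferentiableAt.div (by fun_prop) (by fun_prop) ht

lemma differentiableAt_annulusMap (h0 : 0 < μ) (h1 : μ < 1) (hR : R = μ + μ⁻¹) {t : ℂ}
    (ht : μ ^ 2 ≤ ‖t‖) (ht1 : ‖t‖ ≤ 1) : DifferentiableAt ℂ (annulusMap μ R) t := by
  have hμ : (μ : ℂ) ≠ 0 := by exact_mod_cast h0.ne'
  have e1 : (1 + μ * t : ℂ) ≠ 0 := one_add_mul_ne_zero h0 (by nlinarith)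
  have e2 := add_cube_ne_zero h0 h1 ht
  refine (hasDerivAt_psi ?_).differentiableAt.comp t (differentiableAt_diskMap e1)
  rw [mul_diskMap_sub_one h0 hR e1]
  exact div_ne_zero e2 (mul_ne_zero hμ e1)

lemma psi_image_innerPreimage (h0 : 0 < μ) (h1 : μ < 1) (hR : R = μ + μ⁻¹) :
    psi R '' innerPreimage R = annulusMap μ R '' annulus (μ ^ 2) 1 := by
  rw [innerPreimage_eq h0 h1 hR, image_image]; rfl

lemma isPreconnected_inner (h0 : 0 < μ) (h1 : μ < 1) (hR : R = μ + μ⁻¹) :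
    IsPreconnected (psi R '' innerPreimage R) := by
  rw [psi_image_innerPreimage h0 h1 hR]
  exact (isPreconnected_annulus (by positivity)).image _ fun t ht =>
    (differentiableAt_annulusMap h0 h1 hR ht.1.le ht.2.le).continuousAt.continuousWithinAt

/-- The fixed points `±μ` of `t ↦ μ² / t` lie over the branch values `±2`; comparing the two values
shows that the map is not constant. -/
lemma annulusMap_self (h0 : 0 < μ) (hR : R = μ + μ⁻¹) : annulusMap μ R μ = 2 := by
  have hμ : (μ : ℂ) ≠ 0 := by exact_mod_cast h0.ne'
  have h : (1 + μ * μ : ℂ) ≠ 0 := by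
    have : 1 + μ * μ ≠ 0 := by positivity
    exact_mod_cast this
  rw [annulusMap, psi, mul_diskMap_sub_one h0 hR h]
  have : ((μ : ℂ) + (μ : ℂ) ^ 3) / (μ * (1 + μ * μ)) = 1 := by
    rw [div_eq_one_iff_eq (mul_ne_zero hμ h)]; ring
  rw [this]; norm_num

lemma annulusMap_neg_self (h0 : 0 < μ) (h1 : μ < 1) (hR : R = μ + μ⁻¹) :
    annulusMap μ R (-μ) = -2 := by
  have hμ : (μ : ℂ) ≠ 0 := by exact_mod_cast h0.ne'
  have h : (1 + μ * -μ : ℂ) ≠ 0 := by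
    have : 1 + μ * -μ ≠ 0 := by nlinarith
    exact_mod_cast this
  rw [annulusMap, psi, mul_diskMap_sub_one h0 hR h]
  have : (-(μ : ℂ) + (μ : ℂ) ^ 3) / (μ * (1 + μ * -μ)) = -1 := by
    rw [div_eq_iff (mul_ne_zero hμ h)]; ring
  rw [this]; norm_num

/-- The map is two-to-one here, so `isOpen_image_of_injOn` does not apply; the open mapping theorem
needs only that it is not constant. -/
lemma isOpen_inner (h0 : 0 < μ) (h1 : μ < 1) (hR : R = μ + μ⁻¹) :
    IsOpen (psi R '' innerPreimage R) := by
  rw [psi_image_innerPreimage h0 h1 hR]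
  have han : AnalyticOnNhd ℂ (annulusMap μ R) (annulus (μ ^ 2) 1) :=
    DifferentiableOn.analyticOnNhd (fun t ht =>
      (differentiableAt_annulusMap h0 h1 hR ht.1.le ht.2.le).differentiableWithinAt)
      (isOpen_annulus _ _)
  have hn : ‖(μ : ℂ)‖ = μ := by rw [norm_real, Real.norm_of_nonneg h0.le]
  rcases han.is_constant_or_isOpen (isPreconnected_annulus (by positivity)) with ⟨c, hc⟩ | h
  · exfalso
    have m1 : (μ : ℂ) ∈ annulus (μ ^ 2) 1 := ⟨by rw [hn]; nlinarith, by rwa [hn]⟩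
    have m2 : (-μ : ℂ) ∈ annulus (μ ^ 2) 1 :=
      ⟨by rw [norm_neg, hn]; nlinarith, by rwa [norm_neg, hn]⟩
    have e1 := hc _ m1
    have e2 := hc _ m2
    rw [annulusMap_self h0 hR] at e1
    rw [annulusMap_neg_self h0 h1 hR, ← e1] at e2
    norm_num at e2
  · exact h _ subset_rfl (isOpen_annulus _ _)

lemma isCompact_image_closedAnnulus (h0 : 0 < μ) (h1 : μ < 1) (hR : R = μ + μ⁻¹) :
    IsCompact {t : ℂ | μ ^ 2 ≤ ‖t‖ ∧ ‖t‖ ≤ 1} ∧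
      IsCompact (annulusMap μ R '' {t | μ ^ 2 ≤ ‖t‖ ∧ ‖t‖ ≤ 1}) := by
  have hc : IsCompact {t : ℂ | μ ^ 2 ≤ ‖t‖ ∧ ‖t‖ ≤ 1} := by
    refine Metric.isCompact_of_isClosed_isBounded
      ((isClosed_le continuous_const continuous_norm).inter
        (isClosed_le continuous_norm continuous_const))
      ((isBounded_closedBall (x := (0 : ℂ)) (r := 1)).subset fun t ht => ?_)
    simpa using ht.2
  exact ⟨hc, hc.image_of_continuousOn fun t ht =>
    (differentiableAt_annulusMap h0 h1 hR ht.1 ht.2).continuousAt.continuousWithinAt⟩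

lemma inner_subset_image_closedAnnulus (h0 : 0 < μ) (h1 : μ < 1) (hR : R = μ + μ⁻¹) :
    psi R '' innerPreimage R ⊆ annulusMap μ R '' {t | μ ^ 2 ≤ ‖t‖ ∧ ‖t‖ ≤ 1} := by
  rw [psi_image_innerPreimage h0 h1 hR]
  exact image_mono fun t ht => ⟨ht.1.le, ht.2.le⟩

lemma curve_subset_image_closedAnnulus (h0 : 0 < μ) (h1 : μ < 1) (hR : R = μ + μ⁻¹) :
    curve R ⊆ annulusMap μ R '' {t | μ ^ 2 ≤ ‖t‖ ∧ ‖t‖ ≤ 1} := by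
  rw [curve_eq (two_lt_of_eq h0 h1 hR)]
  rintro _ ⟨w, hw, rfl⟩
  have hw : ‖w‖ = 1 := hw
  have h2 : (1 - μ * w : ℂ) ≠ 0 := one_sub_mul_ne_zero h0 (by rw [hw]; linarith)
  have h3 := norm_diskMap_sq_sub_one (one_add_mul_diskInv_ne_zero h0 h1 h2)
  rw [diskMap_diskInv h0 h1 h2, hw, one_pow, sub_self, zero_mul, eq_comm, mul_eq_zero,
    or_iff_right (by nlinarith), sub_eq_zero,
    pow_eq_one_iff_of_nonneg (norm_nonneg _) two_ne_zero] at h3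
  exact ⟨diskInv μ w, ⟨by rw [h3]; nlinarith, h3.le⟩, by rw [annulusMap, diskMap_diskInv h0 h1 h2]⟩

lemma isOpen_outer (hR : 2 < R) : IsOpen (psi R '' outside 1) := by
  have h : (1 : ℝ) / R ≤ 1 := by
    rw [div_le_one (by linarith)]; linarith
  exact isOpen_image_of_injOn (isOpen_outside 1) subset_rfl (isOpen_outside 1)
    ((differentiableOn_psi hR).mono (outside_subset h))
    ((psi_injOn hR).mono (outside_subset (two_div_lt_one hR).le))

lemma isPreconnected_outer (hR : 2 < R) : IsPreconnected (psi R '' outside 1) := by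
  have h : (1 : ℝ) / R ≤ 1 := by
    rw [div_le_one (by linarith)]; linarith
  exact (isPreconnected_outside zero_le_one).image _
    ((differentiableOn_psi hR).mono (outside_subset h)).continuousOn

lemma isBounded_inner (h0 : 0 < μ) (h1 : μ < 1) (hR : R = μ + μ⁻¹) :
    Bornology.IsBounded (psi R '' innerPreimage R) :=
  (isCompact_image_closedAnnulus h0 h1 hR).2.isBounded.subset
    (inner_subset_image_closedAnnulus h0 h1 hR)

lemma not_isBounded_outer (h0 : 0 < μ) (h1 : μ < 1) (hR : R = μ + μ⁻¹) :
    ¬ Bornology.IsBounded (psi R '' outside 1) := by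
  intro h
  have hc : Bornology.IsBounded (curve R) :=
    (isCompact_image_closedAnnulus h0 h1 hR).2.isBounded.subset
      (curve_subset_image_closedAnnulus h0 h1 hR)
  refine NormedSpace.unbounded_univ ℝ ℂ ?_
  rw [← union_compl_self (curve R), ← compl_curve (two_lt_of_eq h0 h1 hR)]
  exact hc.union ((isBounded_inner h0 h1 hR).union h)

lemma connectedComponentIn_of_mem_inner (h0 : 0 < μ) (h1 : μ < 1) (hR : R = μ + μ⁻¹) {z : ℂ}
    (hz : z ∈ psi R '' innerPreimage R) :
    connectedComponentIn (curve R)ᶜ z = psi R '' innerPreimage R :=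
  have hR2 := two_lt_of_eq h0 h1 hR
  connectedComponentIn_eq_of_separation (isOpen_inner h0 h1 hR) (isOpen_outer hR2)
    (disjoint_inner_outer hR2) (compl_curve hR2) (isPreconnected_inner h0 h1 hR) hz

lemma connectedComponentIn_of_mem_outer (h0 : 0 < μ) (h1 : μ < 1) (hR : R = μ + μ⁻¹) {z : ℂ}
    (hz : z ∈ psi R '' outside 1) :
    connectedComponentIn (curve R)ᶜ z = psi R '' outside 1 :=
  have hR2 := two_lt_of_eq h0 h1 hR
  connectedComponentIn_eq_of_separation (isOpen_outer hR2) (isOpen_inner h0 h1 hR)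
    (disjoint_inner_outer hR2).symm (by rw [union_comm, compl_curve hR2])
    (isPreconnected_outer hR2) hz

theorem interiorDomain_curve (h0 : 0 < μ) (h1 : μ < 1) (hR : R = μ + μ⁻¹) :
    interiorDomain (curve R) = psi R '' innerPreimage R := by
  ext z
  constructor
  · rintro ⟨hz, hb⟩
    rw [← compl_curve (two_lt_of_eq h0 h1 hR)] at hz
    refine hz.resolve_right fun h => not_isBounded_outer h0 h1 hR ?_
    rwa [connectedComponentIn_of_mem_outer h0 h1 hR h] at hb
  · intro hz
    refine ⟨?_, ?_⟩
    · rw [← compl_curve (two_lt_of_eq h0 h1 hR)]; exact Or.inl hz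
    · rw [connectedComponentIn_of_mem_inner h0 h1 hR hz]; exact isBounded_inner h0 h1 hR

theorem exteriorDomain_curve (h0 : 0 < μ) (h1 : μ < 1) (hR : R = μ + μ⁻¹) :
    exteriorDomain (curve R) = psi R '' outside 1 := by
  ext z
  constructor
  · rintro ⟨hz, hb⟩
    rw [← compl_curve (two_lt_of_eq h0 h1 hR)] at hz
    refine hz.resolve_left fun h => hb ?_
    rw [connectedComponentIn_of_mem_inner h0 h1 hR h]; exact isBounded_inner h0 h1 hR
  · intro hz
    refine ⟨?_, ?_⟩
    · rw [← compl_curve (two_lt_of_eq h0 h1 hR)]; exact Or.inr hz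
    · rw [connectedComponentIn_of_mem_outer h0 h1 hR hz]; exact not_isBounded_outer h0 h1 hR

theorem isExteriorMap_psi (h0 : 0 < μ) (h1 : μ < 1) (hR : R = μ + μ⁻¹) :
    IsExteriorMap (curve R) (psi R) := by
  have hR2 := two_lt_of_eq h0 h1 hR
  have h : (1 : ℝ) / R ≤ 1 := by
    rw [div_le_one (by linarith)]; linarith
  refine ⟨(differentiableOn_psi hR2).mono (outside_subset h), ?_, R, by linarith,
    tendsto_psi_div hR2⟩
  rw [exteriorDomain_curve h0 h1 hR]
  exact ((psi_injOn hR2).mono (outside_subset (two_div_lt_one hR2).le)).bijOn_image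

lemma annulusMap_mem_curve (h0 : 0 < μ) (h1 : μ < 1) (hR : R = μ + μ⁻¹) {t : ℂ} (ht : ‖t‖ = 1) :
    annulusMap μ R t ∈ curve R := by
  rw [curve_eq (two_lt_of_eq h0 h1 hR)]
  exact ⟨diskMap μ t, norm_diskMap_eq_one h1 h0 ht, rfl⟩

lemma annulusMap_mem (h0 : 0 < μ) (h1 : μ < 1) (hR : R = μ + μ⁻¹) {t : ℂ}
    (ht : t ∈ annulus (μ ^ 2) 1) : annulusMap μ R t ∈ interiorDomain (curve R) := by
  rw [interiorDomain_curve h0 h1 hR, psi_image_innerPreimage h0 h1 hR]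
  exact mem_image_of_mem _ ht

/-- The modulus of a conformal map of the interior tends to `1` at the curve. -/
lemma exists_radius_norm_sub_one_lt (h0 : 0 < μ) (h1 : μ < 1) (hR : R = μ + μ⁻¹) {φ : ℂ → ℂ}
    (hφ : IsInteriorMap (interiorDomain (curve R)) φ) {ε : ℝ} (hε : 0 < ε) :
    ∃ r < 1, ∀ t, r < ‖t‖ → ‖t‖ < 1 → |‖φ (annulusMap μ R t)‖ - 1| < ε := by
  have hG : IsOpen (interiorDomain (curve R)) := by
    rw [interiorDomain_curve h0 h1 hR]; exact isOpen_inner h0 h1 hR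
  obtain ⟨K, hKG, hK, hKφ⟩ := exists_isCompact_norm_lt hG hφ.differentiableOn hφ.bijOn
    (show 1 - ε < 1 by linarith)
  set A := {t : ℂ | μ ^ 2 ≤ ‖t‖ ∧ ‖t‖ ≤ 1}
  have hA := (isCompact_image_closedAnnulus h0 h1 hR).1
  have hcont : ContinuousOn (annulusMap μ R) A := fun t ht =>
    (differentiableAt_annulusMap h0 h1 hR ht.1 ht.2).continuousAt.continuousWithinAt
  -- This compact set misses `|t| = 1`, which is mapped to the curve, so its moduli stay below some
  -- `r < 1`.
  have hS : IsCompact (A ∩ annulusMap μ R ⁻¹' K) :=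
    hA.of_isClosed_subset (hcont.preimage_isClosed_of_isClosed hA.isClosed hK.isClosed)
      inter_subset_left
  have hr : ∃ r < 1, μ ^ 2 ≤ r ∧ ∀ t ∈ A ∩ annulusMap μ R ⁻¹' K, ‖t‖ ≤ r := by
    have hq : μ ^ 2 < 1 := by nlinarith
    rcases (A ∩ annulusMap μ R ⁻¹' K).eq_empty_or_nonempty with h | h
    · exact ⟨μ ^ 2, hq, le_rfl, by simp [h]⟩
    · obtain ⟨s, hs, hmax⟩ := hS.exists_isMaxOn h continuous_norm.continuousOn
      refine ⟨‖s‖, lt_of_le_of_ne hs.1.2 fun hs1 => ?_, hs.1.1, fun t ht => hmax ht⟩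
      have h2 := annulusMap_mem_curve h0 h1 hR hs1
      exact (hKG hs.2).1 h2
  obtain ⟨r, hr1, hqr, hr⟩ := hr
  refine ⟨r, hr1, fun t ht ht1 => ?_⟩
  have hm := annulusMap_mem h0 h1 hR (t := t) ⟨hqr.trans_lt ht, ht1⟩
  have hnK : annulusMap μ R t ∉ K := fun hK => by
    have := hr t ⟨⟨(hqr.trans_lt ht).le, ht1.le⟩, hK⟩
    linarith
  have h2 := hKφ _ hm hnK
  have h3 : ‖φ (annulusMap μ R t)‖ < 1 := by simpa using hφ.bijOn.mapsTo hm
  rw [abs_lt]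
  constructor <;> linarith

end Annulus

end ZhukovskyDomain

/-! ### Continuation to the punctured plane by repeated reflection. -/

namespace ZhukovskyDomain

open Complex Metric Set Filter Topology ComplexConjugate

section MultiplicativeExtension

lemma meromorphicAt_conj_conj {f : ℂ → ℂ} {z : ℂ} (hf : MeromorphicAt f (conj z)) :
    MeromorphicAt (fun x => conj (f (conj x))) z := by
  obtain ⟨n, h⟩ := hf
  refine ⟨n, ?_⟩
  rw [Complex.analyticAt_iff_eventually_differentiableAt] at h ⊢
  have hc : Tendsto (fun x : ℂ => conj x) (𝓝 z) (𝓝 (conj z)) := continuous_conj.continuousAt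
  filter_upwards [hc.eventually h] with x hx
  have := hx.conj_conj
  simpa [Function.comp_def, map_mul, map_pow] using this

lemma meromorphicAt_reflection {f : ℂ → ℂ} {z : ℂ} {c : ℝ} (hf : MeromorphicAt f (c * conj z)) :
    MeromorphicAt (fun x => reflection (f (c * conj x))) z := by
  have h1 : MeromorphicAt (f ∘ fun x => (c : ℂ) * x) (conj z) :=
    hf.comp_analyticAt (by fun_prop)
  exact (meromorphicAt_conj_conj h1).inv

variable {q : ℝ} {F : ℂ → ℂ}

/-- The integer `k` such that `q ^ (k + 1) < ‖t‖ ≤ q ^ k`. -/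
noncomputable def annulusIndex (q : ℝ) (t : ℂ) : ℤ := ⌊Real.log ‖t‖ / Real.log q⌋

lemma annulusIndex_conj (q : ℝ) (t : ℂ) : annulusIndex q (conj t) = annulusIndex q t := by
  simp [annulusIndex]

lemma annulusIndex_mul (h0 : 0 < q) (h1 : q < 1) {t : ℂ} (ht : t ≠ 0) :
    annulusIndex q (q * t) = annulusIndex q t + 1 := by
  have hl : Real.log q ≠ 0 := (Real.log_neg h0 h1).ne
  rw [annulusIndex, annulusIndex, norm_mul, norm_real, Real.norm_of_nonneg h0.le,
    Real.log_mul h0.ne' (norm_ne_zero_iff.2 ht), add_div, div_self hl, add_comm, Int.floor_add_one]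

lemma annulusIndex_eq_zero (h0 : 0 < q) (h1 : q < 1) {t : ℂ} (ht : q < ‖t‖) (ht1 : ‖t‖ ≤ 1) :
    annulusIndex q t = 0 := by
  have hl : Real.log q < 0 := Real.log_neg h0 h1
  have htp : 0 < ‖t‖ := h0.trans ht
  rw [annulusIndex, Int.floor_eq_zero_iff]
  refine ⟨div_nonneg_of_nonpos (Real.log_nonpos htp.le ht1) hl.le, ?_⟩
  rw [div_lt_one_of_neg hl]
  exact Real.log_lt_log h0 ht

lemma norm_mul_zpow_annulusIndex (h0 : 0 < q) (h1 : q < 1) {t : ℂ} (ht : t ≠ 0) :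
    q < ‖t * (q : ℂ) ^ (-annulusIndex q t)‖ ∧ ‖t * (q : ℂ) ^ (-annulusIndex q t)‖ ≤ 1 := by
  have hl : Real.log q < 0 := Real.log_neg h0 h1
  have htp : 0 < ‖t‖ := norm_pos_iff.2 ht
  have hp : 0 < ‖t‖ * q ^ (-annulusIndex q t) := by positivity
  have hlog : Real.log (‖t‖ * q ^ (-annulusIndex q t)) =
      Real.log ‖t‖ - annulusIndex q t * Real.log q := by
    rw [Real.log_mul htp.ne' (by positivity), Real.log_zpow]; push_cast; ring
  rw [norm_mul, norm_zpow, norm_real, Real.norm_of_nonneg h0.le]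
  have e : Real.log ‖t‖ / Real.log q * Real.log q = Real.log ‖t‖ := div_mul_cancel₀ _ hl.ne
  constructor
  · rw [← Real.log_lt_log_iff h0 hp, hlog]
    have : Real.log ‖t‖ / Real.log q < annulusIndex q t + 1 := Int.lt_floor_add_one _
    nlinarith
  · rw [← Real.log_nonpos_iff hp.le, hlog]
    have : (annulusIndex q t : ℝ) ≤ Real.log ‖t‖ / Real.log q := Int.floor_le _
    nlinarith

open Classical in
/-- A function on `q < |t| < 1`, continued to the punctured plane by reflections in the circles
`|t| = q ^ k`; on the unit circle it is given by `E`. -/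
noncomputable def reflectionExtension (q : ℝ) (F E : ℂ → ℂ) (t : ℂ) : ℂ :=
  if Even (annulusIndex q t) then
    (if ‖t * (q : ℂ) ^ (-annulusIndex q t)‖ < 1 then F else E) (t * (q : ℂ) ^ (-annulusIndex q t))
  else reflection ((if ‖t * (q : ℂ) ^ (-annulusIndex q t)‖ < 1 then F else E)
    (conj (t * (q : ℂ) ^ (-annulusIndex q t))))

lemma reflectionExtension_of_lt (h0 : 0 < q) (h1 : q < 1) (E : ℂ → ℂ) {t : ℂ} (ht : q < ‖t‖)
    (ht1 : ‖t‖ < 1) : reflectionExtension q F E t = F t := by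
  simp [reflectionExtension, annulusIndex_eq_zero h0 h1 ht ht1.le, ht1]

lemma reflectionExtension_of_eq (h0 : 0 < q) (h1 : q < 1) (E : ℂ → ℂ) {t : ℂ}
    (ht1 : ‖t‖ = 1) : reflectionExtension q F E t = E t := by
  simp [reflectionExtension, annulusIndex_eq_zero h0 h1 (h1.trans_eq ht1.symm) ht1.le, ht1]

/-- Raising the index by one flips its parity, which adds one reflection and one conjugation; from
an odd index these cancel the ones present. The equation holds by construction; what needs proof is
meromorphy. -/
lemma reflectionExtension_mul (h0 : 0 < q) (h1 : q < 1) (E : ℂ → ℂ) {t : ℂ} (ht : t ≠ 0) :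
    reflectionExtension q F E (q * t) = reflection (reflectionExtension q F E (conj t)) := by
  have hq : (q : ℂ) ≠ 0 := by exact_mod_cast h0.ne'
  have hs : (q * t : ℂ) * (q : ℂ) ^ (-(annulusIndex q t + 1)) =
      t * (q : ℂ) ^ (-annulusIndex q t) := by
    rw [neg_add, zpow_add₀ hq, zpow_neg_one]
    field_simp
  have hs' : conj t * (q : ℂ) ^ (-annulusIndex q t) =
      conj (t * (q : ℂ) ^ (-annulusIndex q t)) := by
    rw [map_mul, map_zpow₀, conj_ofReal]
  by_cases he : Even (annulusIndex q t)
  · have ho : ¬ Even (annulusIndex q t + 1) := by rwa [Int.even_add_one, not_not]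
    simp only [reflectionExtension, annulusIndex_mul h0 h1 ht, annulusIndex_conj, hs, hs',
      if_pos he, if_neg ho, RCLike.norm_conj]
  · have ho : Even (annulusIndex q t + 1) := Int.even_add_one.2 he
    simp only [reflectionExtension, annulusIndex_mul h0 h1 ht, annulusIndex_conj, hs, hs',
      if_neg he, if_pos ho, RCLike.norm_conj, Complex.conj_conj, reflection_reflection]

/-- A function on `q < |t| < 1` that is invariant under `t ↦ q / t` and has boundary values of
modulus `1` continues to a meromorphic function on the punctured plane. -/
theorem exists_meromorphic_extension (h0 : 0 < q) (h1 : q < 1)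
    (hF : ∀ z, q < ‖z‖ → ‖z‖ < 1 → DifferentiableAt ℂ F z)
    (hlim : ∀ ε > 0, ∃ r < 1, ∀ z, r < ‖z‖ → ‖z‖ < 1 → |‖F z‖ - 1| < ε)
    (hsymm : ∀ z, q < ‖z‖ → ‖z‖ < 1 → F (q / z) = F z) :
    ∃ H : ℂ → ℂ, (∀ t, t ≠ 0 → MeromorphicAt H t) ∧ (∀ t, q < ‖t‖ → ‖t‖ < 1 → H t = F t) ∧
      ∀ t, t ≠ 0 → H (q * t) = reflection (H (conj t)) := by
  obtain ⟨a, E, hqa, ha1, hEd, hEin, hEout⟩ := exists_reflection_extension h0 h1 hF hlim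
  have ha0 : 0 < a := h0.trans hqa
  set H := reflectionExtension q F E with hH
  have hmul : ∀ t, t ≠ 0 → H (q * t) = reflection (H (conj t)) :=
    fun t ht => reflectionExtension_mul h0 h1 E ht
  have hHF : ∀ t, q < ‖t‖ → ‖t‖ < 1 → H t = F t :=
    fun t ht ht1 => reflectionExtension_of_lt h0 h1 E ht ht1
  have hq : (q : ℂ) ≠ 0 := by exact_mod_cast h0.ne'
  have hnq : ‖(q : ℂ)‖ = q := by rw [norm_real, Real.norm_of_nonneg h0.le]
  refine ⟨H, ?_, hHF, hmul⟩
  have hback : ∀ t, t ≠ 0 → H t = reflection (H (q * conj t)) := fun t ht => by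
    rw [hmul (conj t) (by simpa using ht), Complex.conj_conj, reflection_reflection]
  -- Here the invariance enters: for `|t| > 1` the functional equation gives the reflection of `F (q
  -- * conj t) = F (1 / conj t)`, which is the Schwarz extension.
  have hHE : ∀ t, a < ‖t‖ → ‖t‖ < a⁻¹ → H t = E t := by
    intro t hta hta'
    have ht0 : t ≠ 0 := norm_pos_iff.1 (ha0.trans hta)
    rcases lt_trichotomy ‖t‖ 1 with h | h | h
    · rw [hHF t (hqa.trans hta) h, hEin t hta h]
    · exact reflectionExtension_of_eq h0 h1 E h
    · have hc : conj t ≠ 0 := by simpa using ht0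
      have hn : ‖(q * conj t : ℂ)‖ = q * ‖t‖ := by rw [norm_mul, hnq, RCLike.norm_conj]
      have hlt1 : q * ‖t‖ < 1 := by
        calc q * ‖t‖ < a * a⁻¹ := mul_lt_mul'' hqa hta' h0.le (norm_nonneg _)
          _ = 1 := mul_inv_cancel₀ ha0.ne'
      have hgt : q < q * ‖t‖ := by nlinarith
      rw [hback t ht0, hHF _ (by rwa [hn]) (by rwa [hn]),
        ← hsymm _ (by rwa [hn]) (by rwa [hn]), hEout t h hta']
      congr 2
      rw [reflection]; field_simp
  have hfund : ∀ s, q < ‖s‖ → ‖s‖ ≤ 1 → MeromorphicAt H s := by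
    intro s hs hs1
    rcases hs1.lt_or_eq with h | h
    · have han : AnalyticAt ℂ F s := by
        refine DifferentiableOn.analyticAt (s := annulus q 1) (fun z hz => ?_)
          ((isOpen_annulus q 1).mem_nhds ⟨hs, h⟩)
        exact (hF z hz.1 hz.2).differentiableWithinAt
      refine (han.congr ?_).meromorphicAt
      filter_upwards [(isOpen_annulus q 1).mem_nhds ⟨hs, h⟩] with z hz
      exact (hHF z hz.1 hz.2).symm
    · have hm : s ∈ annulus a a⁻¹ := ⟨by rwa [h], by rw [h]; exact (one_lt_inv₀ ha0).2 ha1⟩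
      have han : AnalyticAt ℂ E s := by
        refine DifferentiableOn.analyticAt (s := annulus a a⁻¹) (fun z hz => ?_)
          ((isOpen_annulus a a⁻¹).mem_nhds hm)
        exact (hEd z hz.1 hz.2).differentiableWithinAt
      refine (han.congr ?_).meromorphicAt
      filter_upwards [(isOpen_annulus a a⁻¹).mem_nhds hm] with z hz
      exact (hHE z hz.1 hz.2).symm
  -- The functional equation carries meromorphy from each annulus to its neighbours on both sides.
  have hstep : ∀ n : ℤ, ∀ s, q < ‖s‖ → ‖s‖ ≤ 1 → MeromorphicAt H ((q : ℂ) ^ n * s) := by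
    intro n
    induction n using Int.induction_on with
    | zero => intro s hs hs1; simpa using hfund s hs hs1
    | succ n ih =>
      intro s hs hs1
      have hs0 : s ≠ 0 := norm_pos_iff.1 (h0.trans hs)
      have e : (((q⁻¹ : ℝ) : ℂ) * conj ((q : ℂ) ^ ((n : ℤ) + 1) * s)) =
          (q : ℂ) ^ (n : ℤ) * conj s := by
        rw [map_mul, map_zpow₀, conj_ofReal, zpow_add_one₀ hq]
        push_cast; field_simp
      have hm := ih (conj s) (by simpa using hs) (by simpa using hs1)
      rw [← e] at hm
      refine (meromorphicAt_reflection hm).congr (nhdsWithin_le_nhds ?_)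
      have hne : (q : ℂ) ^ ((n : ℤ) + 1) * s ≠ 0 := mul_ne_zero (zpow_ne_zero _ hq) hs0
      filter_upwards [isOpen_ne.mem_nhds hne] with x hx
      have hx : x ≠ 0 := hx
      have := hmul (((q⁻¹ : ℝ) : ℂ) * x) (by simpa [hq] using hx)
      rw [map_mul, conj_ofReal] at this
      rw [← this]; push_cast
      rw [mul_inv_cancel_left₀ hq]
    | pred n ih =>
      intro s hs hs1
      have hs0 : s ≠ 0 := norm_pos_iff.1 (h0.trans hs)
      have e : ((q : ℂ) * conj ((q : ℂ) ^ (-(n : ℤ) - 1) * s)) =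
          (q : ℂ) ^ (-(n : ℤ)) * conj s := by
        rw [map_mul, map_zpow₀, conj_ofReal, zpow_sub_one₀ hq]
        field_simp
      have hm := ih (conj s) (by simpa using hs) (by simpa using hs1)
      rw [← e] at hm
      refine (meromorphicAt_reflection hm).congr (nhdsWithin_le_nhds ?_)
      have hne : (q : ℂ) ^ (-(n : ℤ) - 1) * s ≠ 0 := mul_ne_zero (zpow_ne_zero _ hq) hs0
      filter_upwards [isOpen_ne.mem_nhds hne] with x hx
      exact (hback x hx).symm
  intro t ht
  obtain ⟨h2, h3⟩ := norm_mul_zpow_annulusIndex h0 h1 ht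
  have := hstep (annulusIndex q t) _ h2 h3
  rwa [mul_comm, mul_assoc, ← zpow_add₀ hq, neg_add_cancel, zpow_zero, mul_one] at this

/-- On the annuli where the continuation is the reflection of a function with modulus less than
`1`, its modulus is at least `1` off the poles. -/
lemma frequently_one_le_norm (h0 : 0 < q) (h1 : q < 1) {H : ℂ → ℂ}
    (hF1 : ∀ t, q < ‖t‖ → ‖t‖ < 1 → ‖F t‖ < 1)
    (hfin : {t : ℂ | (q < ‖t‖ ∧ ‖t‖ < 1) ∧ F t = 0}.Finite)
    (hHF : ∀ t, q < ‖t‖ → ‖t‖ < 1 → H t = F t)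
    (hmul : ∀ t, t ≠ 0 → H (q * t) = reflection (H (conj t))) {t : ℂ} (ht : q ^ 2 ≤ ‖t‖)
    (ht1 : ‖t‖ ≤ q) : ∃ᶠ s in 𝓝[≠] t, 1 ≤ ‖H s‖ := by
  have hq : (q : ℂ) ≠ 0 := by exact_mod_cast h0.ne'
  have hnq : ‖(q : ℂ)‖ = q := by rw [norm_real, Real.norm_of_nonneg h0.le]
  have ht0 : t ≠ 0 := norm_pos_iff.1 (lt_of_lt_of_le (by positivity) ht)
  have htp : 0 < ‖t‖ := norm_pos_iff.2 ht0
  -- At these points the reflection would be infinite; since `reflection 0 = 0`, the value of `H`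
  -- there is `0`, so they must be avoided.
  set S := (fun s : ℂ => q * conj s) '' {t : ℂ | (q < ‖t‖ ∧ ‖t‖ < 1) ∧ F t = 0}
  have hS : S.Finite := hfin.image _
  have hnS : ∀ᶠ s in 𝓝[≠] t, s ∉ S := by
    have := (hS.sdiff (t := {t})).isClosed.isOpen_compl.mem_nhds
      (show t ∈ (S \ {t})ᶜ from fun h => h.2 rfl)
    filter_upwards [nhdsWithin_le_nhds this, self_mem_nhdsWithin] with s h h' hs
    exact h ⟨hs, h'⟩
  have hval : ∀ s, s ∉ S → q ^ 2 < ‖s‖ → ‖s‖ < q → 1 ≤ ‖H s‖ := by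
    intro s hs hs1 hs2
    have hs0 : s ≠ 0 := norm_pos_iff.1 (lt_trans (by positivity) hs1)
    set x : ℂ := conj (s / q)
    have hx : q * conj x = s := by simp only [x, Complex.conj_conj]; field_simp
    have hxn : ‖x‖ = ‖s‖ / q := by simp [x, abs_of_pos h0]
    have hx1 : q < ‖x‖ := by rw [hxn, lt_div_iff₀ h0]; linarith [sq q]
    have hx2 : ‖x‖ < 1 := by rwa [hxn, div_lt_one h0]
    have hFx : F x ≠ 0 := fun h => hs ⟨x, ⟨⟨hx1, hx2⟩, h⟩, hx⟩
    have := hmul (conj x) (by simp [x, hs0, h0.ne'])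
    rw [hx, Complex.conj_conj, hHF x hx1 hx2] at this
    rw [this, norm_reflection]
    exact (one_le_inv₀ (norm_pos_iff.2 hFx)).2 (hF1 x hx1 hx2).le
  -- A radial move enters the open annulus: inwards, or outwards when `|t| = q²`.
  have hray : ∃ᶠ s in 𝓝[≠] t, q ^ 2 < ‖s‖ ∧ ‖s‖ < q := by
    have hn : ∀ x : ℝ, ‖(x * t : ℂ)‖ = |x| * ‖t‖ := fun x => by
      rw [norm_mul, norm_real, Real.norm_eq_abs]
    have hcont : Tendsto (fun x : ℝ => (x * t : ℂ)) (𝓝 1) (𝓝 t) := by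
      have : ContinuousAt (fun x : ℝ => (x * t : ℂ)) 1 := by fun_prop
      simpa [ContinuousAt] using this
    have hne : ∀ x : ℝ, x ≠ 1 → (x * t : ℂ) ≠ t := fun x hx h => by
      have : (x : ℂ) = 1 := mul_right_cancel₀ ht0 (by rw [h, one_mul])
      exact hx (by exact_mod_cast this)
    have hnc : ContinuousAt (fun x : ℝ => ‖(x * t : ℂ)‖) 1 := by fun_prop
    rcases ht.lt_or_eq with h | h
    · have hT : Tendsto (fun x : ℝ => (x * t : ℂ)) (𝓝[<] 1) (𝓝[≠] t) :=
        tendsto_nhdsWithin_of_tendsto_nhds_of_eventually_within _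
          (hcont.mono_left nhdsWithin_le_nhds)
          (by filter_upwards [self_mem_nhdsWithin] with x hx using hne x (ne_of_lt hx))
      refine hT.frequently (Eventually.frequently ?_)
      have e1 : ∀ᶠ x : ℝ in 𝓝[<] 1, q ^ 2 < ‖(x * t : ℂ)‖ :=
        nhdsWithin_le_nhds (continuousAt_const.eventually_lt hnc (by simpa using h))
      filter_upwards [e1, self_mem_nhdsWithin, nhdsWithin_le_nhds (Ioi_mem_nhds zero_lt_one)]
        with x hx1 hx2 hx3
      refine ⟨hx1, ?_⟩
      have hx2 : x < 1 := hx2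
      rw [hn, abs_of_pos hx3]
      nlinarith
    · have hT : Tendsto (fun x : ℝ => (x * t : ℂ)) (𝓝[>] 1) (𝓝[≠] t) :=
        tendsto_nhdsWithin_of_tendsto_nhds_of_eventually_within _
          (hcont.mono_left nhdsWithin_le_nhds)
          (by filter_upwards [self_mem_nhdsWithin] with x hx using hne x (ne_of_gt hx))
      refine hT.frequently (Eventually.frequently ?_)
      have e1 : ∀ᶠ x : ℝ in 𝓝[>] 1, ‖(x * t : ℂ)‖ < q :=
        nhdsWithin_le_nhds (hnc.eventually_lt continuousAt_const (by
          simp only [ofReal_one, one_mul]; rw [← h]; nlinarith))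
      filter_upwards [e1, self_mem_nhdsWithin] with x hx1 hx2
      refine ⟨?_, hx1⟩
      have hx2 : 1 < x := hx2
      rw [hn, abs_of_pos (by linarith)]
      nlinarith
  exact (hray.and_eventually hnS).mono fun s hs => hval s hs.2 hs.1.1 hs.1.2

end MultiplicativeExtension

end ZhukovskyDomain

/-! ### The two roots `v₊` and `v₋`. -/

namespace ZhukovskyDomain

open Complex Metric Set Filter Topology ComplexConjugate

section Roots

variable {R : ℝ}

lemma sqrtBranch_sq (z : ℂ) : sqrtBranch z ^ 2 = z ^ 2 - 4 := by
  have h : ∀ a : ℂ, (a ^ (1 / 2 : ℂ)) ^ 2 = a := fun a => by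
    simp
  rw [sqrtBranch, mul_pow, h, h]; ring

lemma mul_vPlus_sub_one (hR : 2 < R) (z : ℂ) :
    (R * vPlus R z - 1 : ℂ) = (z + sqrtBranch z) / 2 := by
  have hR0 : (R : ℂ) ≠ 0 := by exact_mod_cast (by linarith : R ≠ 0)
  rw [vPlus]; field_simp; ring

lemma mul_vMinus_sub_one (hR : 2 < R) (z : ℂ) :
    (R * vMinus R z - 1 : ℂ) = (z - sqrtBranch z) / 2 := by
  have hR0 : (R : ℂ) ≠ 0 := by exact_mod_cast (by linarith : R ≠ 0)
  rw [vMinus]; field_simp; ring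

lemma vPlus_mul_vMinus (hR : 2 < R) (z : ℂ) :
    (R * vPlus R z - 1) * (R * vMinus R z - 1) = (1 : ℂ) := by
  rw [mul_vPlus_sub_one hR, mul_vMinus_sub_one hR]
  linear_combination (-1 / 4) * sqrtBranch_sq z

lemma psi_eq_iff (hR : 2 < R) {w z : ℂ} (hw : (R * w - 1 : ℂ) ≠ 0) :
    psi R w = z ↔ w = vPlus R z ∨ w = vMinus R z := by
  have hR0 : (R : ℂ) ≠ 0 := by exact_mod_cast (by linarith : R ≠ 0)
  have h1 : psi R w = z ↔ (R * w - 1 - (R * vPlus R z - 1)) * (R * w - 1 - (R * vMinus R z - 1)) =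
      (0 : ℂ) := by
    have e : (R * w - 1 - (R * vPlus R z - 1)) * (R * w - 1 - (R * vMinus R z - 1)) =
        (R * w - 1) ^ 2 - (R * w - 1) * z + (1 : ℂ) := by
      have hs : (R * vPlus R z - 1) + (R * vMinus R z - 1) = z := by
        rw [mul_vPlus_sub_one hR, mul_vMinus_sub_one hR]; ring
      linear_combination vPlus_mul_vMinus hR z - (R * w - 1) * hs
    rw [e, psi]
    set u : ℂ := R * w - 1
    constructor
    · rintro rfl; field_simp; ring
    · intro h; field_simp; linear_combination h
  rw [h1, mul_eq_zero]
  refine or_congr ?_ ?_ <;>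
  · rw [sub_sub_sub_cancel_right, ← mul_sub, mul_eq_zero, or_iff_right hR0, sub_eq_zero]

lemma psi_vPlus (hR : 2 < R) (z : ℂ) : psi R (vPlus R z) = z :=
  (psi_eq_iff hR (left_ne_zero_of_mul_eq_one (vPlus_mul_vMinus hR z))).2 (Or.inl rfl)

lemma psi_vMinus (hR : 2 < R) (z : ℂ) : psi R (vMinus R z) = z :=
  (psi_eq_iff hR (right_ne_zero_of_mul_eq_one (vPlus_mul_vMinus hR z))).2 (Or.inr rfl)

end Roots

/-! ### The periodic continuation and the least radius. -/

section Continuation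

variable {μ R : ℝ} {φ H h : ℂ → ℂ}

/-- With `x = diskMap μ t`, the scaled point has modulus at most `1 / (R - |x|)`. The hypothesis
then forces `|x| > μ`, and `1 / (R - |x|) < |x|` amounts to `(|x| - μ)(μ⁻¹ - |x|) > 0`. -/
lemma norm_diskMap_sq_mul_lt (h0 : 0 < μ) (h1 : μ < 1) (hR : R = μ + μ⁻¹) {t : ℂ} (ht : ‖t‖ < 1)
    (hμ : μ < ‖diskMap μ ((μ : ℂ) ^ 2 * t)‖) :
    μ < ‖diskMap μ t‖ ∧ ‖diskMap μ ((μ : ℂ) ^ 2 * t)‖ < ‖diskMap μ t‖ := by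
  have hne : (1 + μ * t : ℂ) ≠ 0 := one_add_mul_ne_zero h0 (by nlinarith [norm_nonneg t])
  have hx := (norm_diskMap_lt_one_iff h0 h1 hne).2 ht
  have hR2 := two_lt_of_eq h0 h1 hR
  rw [diskMap_sq_mul h0 hR hne, norm_inv] at hμ ⊢
  set x := diskMap μ t
  have hi : μ * μ⁻¹ = 1 := mul_inv_cancel₀ h0.ne'
  have hd : R - ‖x‖ ≤ ‖(R - x : ℂ)‖ := by
    have := norm_sub_norm_le (R : ℂ) x
    rwa [norm_real, Real.norm_of_nonneg (by linarith)] at this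
  have hdp : 0 < R - ‖x‖ := by linarith
  have hle : ‖(R - x : ℂ)‖⁻¹ ≤ (R - ‖x‖)⁻¹ := inv_anti₀ hdp hd
  have hμx : μ < ‖x‖ := by
    have h3 : R - ‖x‖ < μ⁻¹ := (lt_inv_comm₀ h0 hdp).1 (hμ.trans_le hle)
    linarith
  refine ⟨hμx, hle.trans_lt ?_⟩
  rw [inv_lt_iff_one_lt_mul₀ hdp]
  have h3 : 1 < μ⁻¹ := (one_lt_inv₀ h0).2 h1
  nlinarith [mul_pos (sub_pos.2 hμx) (show 0 < μ⁻¹ - ‖x‖ by linarith)]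

lemma norm_diskMap_pow_mul_lt (h0 : 0 < μ) (h1 : μ < 1) (hR : R = μ + μ⁻¹) {t : ℂ} (ht : ‖t‖ < 1)
    (n : ℕ) (hμ : μ < ‖diskMap μ (((μ : ℂ) ^ 2) ^ (n + 1) * t)‖) :
    μ < ‖diskMap μ t‖ ∧ ‖diskMap μ (((μ : ℂ) ^ 2) ^ (n + 1) * t)‖ < ‖diskMap μ t‖ := by
  have hpow : ∀ n : ℕ, ‖((μ : ℂ) ^ 2) ^ n * t‖ < 1 := fun n => by
    rw [norm_mul, norm_pow, norm_pow, norm_real, Real.norm_of_nonneg h0.le]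
    have : (μ ^ 2) ^ n ≤ 1 := pow_le_one₀ (by positivity) (by nlinarith)
    calc (μ ^ 2) ^ n * ‖t‖ ≤ 1 * ‖t‖ := by gcongr
      _ < 1 := by rwa [one_mul]
  induction n with
  | zero =>
    rw [zero_add, pow_one] at hμ ⊢
    exact norm_diskMap_sq_mul_lt h0 h1 hR ht hμ
  | succ n ih =>
    have e : ((μ : ℂ) ^ 2) ^ (n + 1 + 1) * t = (μ : ℂ) ^ 2 * (((μ : ℂ) ^ 2) ^ (n + 1) * t) := by ring
    rw [e] at hμ ⊢
    obtain ⟨h3, h4⟩ := norm_diskMap_sq_mul_lt h0 h1 hR (hpow _) hμ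
    obtain ⟨h5, h6⟩ := ih h3
    exact ⟨h5, h4.trans h6⟩

/-- `H` continues `φ ∘ psi R`, in the coordinate of `diskMap`, to a meromorphic function on the
punctured plane with multiplicative period `μ ^ 4`. -/
structure IsPeriodicContinuation (μ R : ℝ) (φ H : ℂ → ℂ) : Prop where
  meromorphicAt : ∀ t, t ≠ 0 → MeromorphicAt H t
  eq_comp : ∀ t ∈ annulus (μ ^ 2) 1, H t = φ (annulusMap μ R t)
  periodic : ∀ t, t ≠ 0 → ∀ j : ℕ, H (((μ : ℂ) ^ 4) ^ j * t) = H t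
  frequently_one_le : ∀ t : ℂ, μ ^ 4 ≤ ‖t‖ → ‖t‖ ≤ μ ^ 2 → ∃ᶠ s in 𝓝[≠] t, 1 ≤ ‖H s‖

lemma mul_annulusMap_ne_zero (h0 : 0 < μ) (h1 : μ < 1) (hR : R = μ + μ⁻¹) {t : ℂ}
    (ht : t ∈ annulus (μ ^ 2) 1) : (R * diskMap μ t - 1 : ℂ) ≠ 0 := by
  have := mem_image_of_mem (diskMap μ) ht
  rw [← innerPreimage_eq h0 h1 hR] at this
  exact mul_sub_one_ne_zero_of_mem this

theorem exists_isPeriodicContinuation (h0 : 0 < μ) (h1 : μ < 1) (hR : R = μ + μ⁻¹)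
    (hφ : IsInteriorMap (interiorDomain (curve R)) φ) :
    ∃ H, IsPeriodicContinuation μ R φ H := by
  have hq0 : 0 < μ ^ 2 := by positivity
  have hq1 : μ ^ 2 < 1 := by nlinarith
  have hR2 := two_lt_of_eq h0 h1 hR
  have hG : IsOpen (interiorDomain (curve R)) := by
    rw [interiorDomain_curve h0 h1 hR]; exact isOpen_inner h0 h1 hR
  have hmem : ∀ t, μ ^ 2 < ‖t‖ → ‖t‖ < 1 → annulusMap μ R t ∈ interiorDomain (curve R) :=
    fun t h h' => annulusMap_mem h0 h1 hR ⟨h, h'⟩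
  obtain ⟨H, hH1, hH2, hH3⟩ := exists_meromorphic_extension (q := μ ^ 2)
    (F := fun t => φ (annulusMap μ R t)) hq0 hq1
    (fun z hz hz1 => (hφ.differentiableOn.differentiableAt (hG.mem_nhds (hmem z hz hz1))).comp z
      (differentiableAt_annulusMap h0 h1 hR hz.le hz1.le))
    (fun ε hε => exists_radius_norm_sub_one_lt h0 h1 hR hφ hε)
    (fun z hz hz1 => by
      have := annulusMap_sq_div h0 h1 hR hz.le hz1.le
      push_cast
      rw [this])
  have hμ : (μ : ℂ) ≠ 0 := by exact_mod_cast h0.ne'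
  refine ⟨H, hH1, fun t ht => hH2 t ht.1 ht.2, ?_, ?_⟩
  · intro t ht j
    -- Two applications of the reflection equation cancel the reflections.
    have hper : ∀ t, t ≠ 0 → H ((μ : ℂ) ^ 4 * t) = H t := by
      intro t ht
      have h2 := hH3 (((μ ^ 2 : ℝ) : ℂ) * t) (mul_ne_zero (by exact_mod_cast hq0.ne') ht)
      rw [map_mul, conj_ofReal, hH3 (conj t) (by simpa using ht), Complex.conj_conj,
        reflection_reflection] at h2
      rw [← h2]; push_cast; ring_nf
    induction j with
    | zero => simp
    | succ j ih =>
      rw [pow_succ', mul_assoc, hper _ (mul_ne_zero (pow_ne_zero _ (pow_ne_zero _ hμ)) ht), ih]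
  · intro t ht ht1
    refine frequently_one_le_norm (q := μ ^ 2) (F := fun t => φ (annulusMap μ R t)) hq0 hq1
      (fun t h h' => by simpa using hφ.bijOn.mapsTo (hmem t h h')) ?_ hH2 hH3
      (by rw [← pow_mul]; exact ht) ht1
    -- The zeros of `φ ∘ annulusMap` lie over the only zero of `φ`, which has at most two preimages.
    obtain ⟨z₀, hz₀, hφz₀⟩ := hφ.bijOn.surjOn (show (0 : ℂ) ∈ ball 0 1 by simp)
    refine ((Set.toFinite {vPlus R z₀, vMinus R z₀}).image (diskInv μ)).subset ?_
    rintro t ⟨⟨ht, ht1⟩, hz⟩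
    have e := hφ.bijOn.injOn (hmem t ht ht1) hz₀ (hz.trans hφz₀.symm)
    refine ⟨diskMap μ t, (psi_eq_iff hR2 (mul_annulusMap_ne_zero h0 h1 hR ⟨ht, ht1⟩)).1 e, ?_⟩
    exact diskInv_diskMap h0 h1 (one_add_mul_ne_zero h0 (by nlinarith [norm_nonneg t]))

/-- This keeps the pole `1 / μ` of `diskInv μ` off the wide annulus, and `2 / R < |w| < 1` inside `μ
< |w| < 1`. -/
lemma mul_two_div_lt (h0 : 0 < μ) (h1 : μ < 1) (hR : R = μ + μ⁻¹) : μ < 2 / R := by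
  have hR2 := two_lt_of_eq h0 h1 hR
  rw [lt_div_iff₀ (by linarith), hR, mul_add, mul_inv_cancel₀ h0.ne']
  nlinarith

lemma one_sub_mul_ne_zero_of_mem (h0 : 0 < μ) (h1 : μ < 1) (hR : R = μ + μ⁻¹) {m : ℝ} {w : ℂ}
    (hw : w ∈ wideAnnulus m (2 / R)) : (1 - μ * w : ℂ) ≠ 0 := by
  refine one_sub_mul_ne_zero h0 (lt_of_le_of_lt ?_ hw.2)
  have := mul_two_div_lt h0 h1 hR
  gcongr

lemma diskInv_ne_zero (h0 : 0 < μ) (h1 : μ < 1) (hR : R = μ + μ⁻¹) {w : ℂ}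
    (hw : w ∈ wideAnnulus μ (2 / R)) : diskInv μ w ≠ 0 := by
  refine div_ne_zero (fun h => ?_) (one_sub_mul_ne_zero_of_mem h0 h1 hR hw)
  have := hw.1
  rw [sub_eq_zero.1 h, norm_real, Real.norm_of_nonneg h0.le] at this
  exact lt_irrefl _ this

lemma analyticAt_diskInv {w : ℂ} (hw : (1 - μ * w : ℂ) ≠ 0) : AnalyticAt ℂ (diskInv μ) w :=
  AnalyticAt.div (by fun_prop) (by fun_prop) hw

lemma meromorphicAt_comp_diskInv (h0 : 0 < μ) (h1 : μ < 1) (hR : R = μ + μ⁻¹)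
    (hH : IsPeriodicContinuation μ R φ H) {w : ℂ} (hw : w ∈ wideAnnulus μ (2 / R)) :
    MeromorphicAt (H ∘ diskInv μ) w :=
  (hH.meromorphicAt _ (diskInv_ne_zero h0 h1 hR hw)).comp_analyticAt
    (analyticAt_diskInv (one_sub_mul_ne_zero_of_mem h0 h1 hR hw))

lemma isOpen_wideAnnulus (m ρ : ℝ) : IsOpen (wideAnnulus m ρ) :=
  (isOpen_lt continuous_const continuous_norm).inter
    (isOpen_lt (continuous_const.mul continuous_norm) continuous_const)

lemma isPreconnected_wideAnnulus {m ρ : ℝ} (hm : 0 ≤ m) (hρ : 0 < ρ) :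
    IsPreconnected (wideAnnulus m ρ) := by
  have : wideAnnulus m ρ = annulus m ρ⁻¹ := by
    ext w
    refine and_congr_right fun _ => ?_
    rw [inv_eq_one_div, lt_div_iff₀ hρ, mul_comm]
  rw [this]
  exact isPreconnected_annulus hm

lemma mem_innerPreimage_of_mem_annulus (hR : 2 < R) {w : ℂ} (hw : w ∈ annulus (2 / R) 1) :
    w ∈ innerPreimage R := by
  have h1 := hw.1
  have h2 := hw.2
  rw [div_lt_iff₀ (by linarith)] at h1
  have h := norm_sub_norm_le ((R : ℂ) * w) 1
  rw [norm_mul, norm_real, Real.norm_of_nonneg (by linarith), norm_one] at h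
  exact ⟨h2, by linarith⟩

lemma diskInv_mem_annulus_iff (h0 : 0 < μ) (h1 : μ < 1) (hR : R = μ + μ⁻¹) {w : ℂ}
    (hw : (1 - μ * w : ℂ) ≠ 0) : diskInv μ w ∈ annulus (μ ^ 2) 1 ↔ w ∈ innerPreimage R := by
  rw [← diskMap_mem_innerPreimage_iff h0 h1 hR (one_add_mul_diskInv_ne_zero h0 h1 hw),
    diskMap_diskInv h0 h1 hw]

lemma comp_diskInv_eq (h0 : 0 < μ) (h1 : μ < 1) (hR : R = μ + μ⁻¹)
    (hH : IsPeriodicContinuation μ R φ H) {w : ℂ} (hw : (1 - μ * w : ℂ) ≠ 0)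
    (hwi : w ∈ innerPreimage R) : (H ∘ diskInv μ) w = φ (psi R w) := by
  rw [Function.comp_apply, hH.eq_comp _ ((diskInv_mem_annulus_iff h0 h1 hR hw).2 hwi), annulusMap,
    diskMap_diskInv h0 h1 hw]

lemma annulus_subset_wideAnnulus (h0 : 0 < μ) (h1 : μ < 1) (hR : R = μ + μ⁻¹) :
    annulus μ 1 ⊆ wideAnnulus μ (2 / R) := by
  intro w hw
  have hw2 : ‖w‖ < 1 := hw.2
  have h2 := two_div_lt_one (two_lt_of_eq h0 h1 hR)
  refine ⟨hw.1, ?_⟩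
  nlinarith [norm_nonneg w]

/-- Identity theorem for meromorphic functions: the difference has infinite order at a point of `2 /
R < |w| < 1`, hence on the whole connected annulus. Allowing `m < μ` prepares the proof of
minimality. -/
lemma eventuallyEq_comp_diskInv (h0 : 0 < μ) (h1 : μ < 1) (hR : R = μ + μ⁻¹)
    (hH : IsPeriodicContinuation μ R φ H) {m : ℝ} (hm : m ≤ μ)
    (hh : IsMeromorphicContinuation (psi R) φ m h) {w : ℂ} (hw : w ∈ wideAnnulus μ (2 / R)) :
    h =ᶠ[𝓝[≠] w] H ∘ diskInv μ := by
  have hR2 := two_lt_of_eq h0 h1 hR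
  have h2R := two_div_lt_one hR2
  have h2R0 : 0 < 2 / R := by positivity
  have hμ2 := mul_two_div_lt h0 h1 hR
  obtain ⟨hh1, hh2⟩ := hh
  rw [rho_psi hR2] at hh1 hh2
  have hsub : wideAnnulus μ (2 / R) ⊆ wideAnnulus m (2 / R) := fun x hx => ⟨hm.trans_lt hx.1, hx.2⟩
  have hmer : MeromorphicOn (h - H ∘ diskInv μ) (wideAnnulus μ (2 / R)) := fun x hx =>
    (hh1 (hsub hx)).meromorphicAt.sub (meromorphicAt_comp_diskInv h0 h1 hR hH hx)
  obtain ⟨r, hr1, hr2⟩ := exists_between h2R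
  have hrn : ‖(r : ℂ)‖ = r := by rw [norm_real, Real.norm_of_nonneg (h2R0.trans hr1).le]
  have hra : (r : ℂ) ∈ annulus (2 / R) 1 := ⟨by rwa [hrn], by rwa [hrn]⟩
  have hrw : (r : ℂ) ∈ wideAnnulus μ (2 / R) :=
    annulus_subset_wideAnnulus h0 h1 hR ⟨hμ2.trans hra.1, hra.2⟩
  have htop : meromorphicOrderAt (h - H ∘ diskInv μ) (r : ℂ) = ⊤ := by
    rw [meromorphicOrderAt_eq_top_iff]
    filter_upwards [nhdsWithin_le_nhds ((isOpen_annulus (2 / R) 1).mem_nhds hra)] with x hx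
    have hxw := annulus_subset_wideAnnulus h0 h1 hR ⟨hμ2.trans hx.1, hx.2⟩
    rw [Pi.sub_apply, hh2 x hx, comp_diskInv_eq h0 h1 hR hH
      (one_sub_mul_ne_zero_of_mem h0 h1 hR hxw) (mem_innerPreimage_of_mem_annulus hR2 hx), sub_self]
  have : meromorphicOrderAt (h - H ∘ diskInv μ) w = ⊤ := by
    by_contra hne
    exact hmer.meromorphicOrderAt_ne_top_of_isPreconnected
      (isPreconnected_wideAnnulus h0.le h2R0) hw hrw hne htop
  rw [meromorphicOrderAt_eq_top_iff] at this
  filter_upwards [this] with x hx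
  exact sub_eq_zero.1 hx

/-- Periodicity gives the equality on a punctured neighbourhood; since the right side is analytic,
the normal form of `h` extends it to the centre. -/
lemma eventuallyEq_phi_comp (h0 : 0 < μ) (h1 : μ < 1) (hR : R = μ + μ⁻¹)
    (hφ : IsInteriorMap (interiorDomain (curve R)) φ)
    (hH : IsPeriodicContinuation μ R φ H) {m : ℝ} (hm : m ≤ μ)
    (hh : IsMeromorphicContinuation (psi R) φ m h) {w : ℂ} (hw : w ∈ wideAnnulus μ (2 / R)) {j : ℕ}
    {s : ℂ} (hs : s ∈ annulus (μ ^ 2) 1) (hj : diskInv μ w = ((μ : ℂ) ^ 4) ^ j * s) :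
    h =ᶠ[𝓝 w] fun x => φ (annulusMap μ R (diskInv μ x / ((μ : ℂ) ^ 4) ^ j)) := by
  have hμ : (μ : ℂ) ≠ 0 := by exact_mod_cast h0.ne'
  have hc : ((μ : ℂ) ^ 4) ^ j ≠ 0 := pow_ne_zero _ (pow_ne_zero _ hμ)
  have hne := one_sub_mul_ne_zero_of_mem h0 h1 hR hw
  have hG : IsOpen (interiorDomain (curve R)) := by
    rw [interiorDomain_curve h0 h1 hR]; exact isOpen_inner h0 h1 hR
  have han : AnalyticAt ℂ (fun x => diskInv μ x / ((μ : ℂ) ^ 4) ^ j) w :=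
    (analyticAt_diskInv hne).div_const
  have hval : diskInv μ w / ((μ : ℂ) ^ 4) ^ j = s := by rw [hj, mul_div_cancel_left₀ _ hc]
  have hA : AnalyticAt ℂ (fun x => φ (annulusMap μ R (diskInv μ x / ((μ : ℂ) ^ 4) ^ j))) w := by
    have h2 : AnalyticAt ℂ (fun t => φ (annulusMap μ R t)) s := by
      refine DifferentiableOn.analyticAt (s := annulus (μ ^ 2) 1) (fun t ht => ?_)
        ((isOpen_annulus _ _).mem_nhds hs)
      exact ((hφ.differentiableOn.differentiableAt (hG.mem_nhds (annulusMap_mem h0 h1 hR ht))).comp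
        t (differentiableAt_annulusMap h0 h1 hR ht.1.le ht.2.le)).differentiableWithinAt
    rw [← hval] at h2
    exact AnalyticAt.comp (g := fun t => φ (annulusMap μ R t)) h2 han
  have hnf : MeromorphicNFAt h w := by
    obtain ⟨hh1, -⟩ := hh
    rw [rho_psi (two_lt_of_eq h0 h1 hR)] at hh1
    exact hh1 ⟨hm.trans_lt hw.1, hw.2⟩
  rw [← hnf.eventuallyEq_nhdsNE_iff_eventuallyEq_nhds hA.meromorphicNFAt]
  refine (eventuallyEq_comp_diskInv h0 h1 hR hH hm hh hw).trans (nhdsWithin_le_nhds ?_)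
  have : annulus (μ ^ 2) 1 ∈ 𝓝 (diskInv μ w / ((μ : ℂ) ^ 4) ^ j) := by
    rw [hval]; exact (isOpen_annulus _ _).mem_nhds hs
  filter_upwards [han.continuousAt this] with x hx
  have hx0 : diskInv μ x / ((μ : ℂ) ^ 4) ^ j ≠ 0 := by
    refine norm_pos_iff.1 (lt_trans ?_ hx.1); positivity
  have h3 := hH.periodic _ hx0 j
  rw [mul_div_cancel₀ _ hc, hH.eq_comp _ hx] at h3
  exact h3

lemma eventuallyEq_phi_psi (h0 : 0 < μ) (h1 : μ < 1) (hR : R = μ + μ⁻¹)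
    (hφ : IsInteriorMap (interiorDomain (curve R)) φ)
    (hH : IsPeriodicContinuation μ R φ H)
    (hh : IsMeromorphicContinuation (psi R) φ μ h) {w : ℂ} (hw : w ∈ innerPreimage R)
    (hwμ : μ < ‖w‖) : h =ᶠ[𝓝 w] fun x => φ (psi R x) := by
  have hw' := annulus_subset_wideAnnulus h0 h1 hR ⟨hwμ, hw.1⟩
  have hne := one_sub_mul_ne_zero_of_mem h0 h1 hR hw'
  refine (eventuallyEq_phi_comp h0 h1 hR hφ hH le_rfl hh hw' (j := 0) (s := diskInv μ w)
    ((diskInv_mem_annulus_iff h0 h1 hR hne).2 hw) (by simp)).trans ?_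
  filter_upwards [(isOpen_wideAnnulus μ (2 / R)).mem_nhds hw'] with x hx
  rw [pow_zero, div_one, annulusMap,
    diskMap_diskInv h0 h1 (one_sub_mul_ne_zero_of_mem h0 h1 hR hx)]

theorem exists_isMeromorphicContinuation (h0 : 0 < μ) (h1 : μ < 1) (hR : R = μ + μ⁻¹)
    (hφ : IsInteriorMap (interiorDomain (curve R)) φ)
    (hH : IsPeriodicContinuation μ R φ H) : ∃ h, IsMeromorphicContinuation (psi R) φ μ h := by
  have hR2 := two_lt_of_eq h0 h1 hR
  have hG : IsOpen (interiorDomain (curve R)) := by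
    rw [interiorDomain_curve h0 h1 hR]; exact isOpen_inner h0 h1 hR
  have hmer : MeromorphicOn (H ∘ diskInv μ) (wideAnnulus μ (2 / R)) :=
    fun x hx => meromorphicAt_comp_diskInv h0 h1 hR hH hx
  refine ⟨toMeromorphicNFOn (H ∘ diskInv μ) (wideAnnulus μ (2 / R)), ?_, ?_⟩
  · rw [rho_psi hR2]; exact meromorphicNFOn_toMeromorphicNFOn _ _
  · rw [rho_psi hR2]
    intro w hw
    have hsub : annulus (2 / R) 1 ⊆ wideAnnulus μ (2 / R) := fun x hx =>
      annulus_subset_wideAnnulus h0 h1 hR ⟨(mul_two_div_lt h0 h1 hR).trans hx.1, hx.2⟩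
    have heq : EqOn (H ∘ diskInv μ) (fun x => φ (psi R x)) (annulus (2 / R) 1) := fun x hx =>
      comp_diskInv_eq h0 h1 hR hH (one_sub_mul_ne_zero_of_mem h0 h1 hR (hsub hx))
        (mem_innerPreimage_of_mem_annulus hR2 hx)
    have hA : AnalyticAt ℂ (fun x => φ (psi R x)) w := by
      refine DifferentiableOn.analyticAt (s := annulus (2 / R) 1) (fun t ht => ?_)
        ((isOpen_annulus _ _).mem_nhds hw)
      have hti := mem_innerPreimage_of_mem_annulus hR2 ht
      have htG : psi R t ∈ interiorDomain (curve R) := by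
        rw [interiorDomain_curve h0 h1 hR]; exact mem_image_of_mem _ hti
      exact ((hφ.differentiableOn.differentiableAt (hG.mem_nhds htG)).comp
        t (hasDerivAt_psi (mul_sub_one_ne_zero_of_mem hti)).differentiableAt).differentiableWithinAt
    have hev := heq.eventuallyEq_of_mem ((isOpen_annulus _ _).mem_nhds hw)
    have h3 := hmer.toMeromorphicNFOn_eq_self_on_nhdsNE (hsub hw)
    have h4 := ((meromorphicNFOn_toMeromorphicNFOn (H ∘ diskInv μ) (wideAnnulus μ (2 / R))
      (hsub hw)).eventuallyEq_nhdsNE_iff_eventuallyEq_nhds hA.meromorphicNFAt).1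
      (h3.trans (hev.filter_mono nhdsWithin_le_nhds))
    exact h4.eq_of_nhds

theorem le_of_isMeromorphicContinuation (h0 : 0 < μ) (h1 : μ < 1) (hR : R = μ + μ⁻¹)
    (hφ : IsInteriorMap (interiorDomain (curve R)) φ)
    (hH : IsPeriodicContinuation μ R φ H) {m : ℝ}
    (hh : IsMeromorphicContinuation (psi R) φ m h) : μ ≤ m := by
  by_contra! hm
  have hR2 := two_lt_of_eq h0 h1 hR
  have h2R := two_div_lt_one hR2
  have hμ2 := mul_two_div_lt h0 h1 hR
  have hμn : ‖(μ : ℂ)‖ = μ := by rw [norm_real, Real.norm_of_nonneg h0.le]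
  have hmer : MeromorphicAt h μ := by
    refine (hh.1 ?_).meromorphicAt
    rw [rho_psi hR2]
    refine ⟨by rwa [hμn], ?_⟩
    rw [hμn]
    nlinarith
  -- Shifting the coordinate of `x` by periods gives real points that tend to `μ` and at which `h`
  -- equals `φ (psi R x)`; a function meromorphic at `μ` must then be constant near `μ`.
  have key : ∀ x : ℝ, 2 / R < x → x < 1 → ∀ᶠ w in 𝓝[≠] (μ : ℂ), h w = φ (psi R x) := by
    intro x hx hx1
    have hx0 : 0 < x := by linarith
    have hxn : ‖(x : ℂ)‖ = x := by rw [norm_real, Real.norm_of_nonneg hx0.le]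
    have hxa : (x : ℂ) ∈ annulus (2 / R) 1 := ⟨by rwa [hxn], by rwa [hxn]⟩
    have hxi := mem_innerPreimage_of_mem_annulus hR2 hxa
    have hne : (1 - μ * x : ℂ) ≠ 0 := one_sub_mul_ne_zero h0 (by rw [hxn]; nlinarith)
    have hs := (diskInv_mem_annulus_iff h0 h1 hR hne).2 hxi
    set s : ℝ := (x - μ) / (1 - μ * x) with hsdef
    have hsc : diskInv μ x = (s : ℂ) := by rw [diskInv, hsdef]; push_cast; rfl
    have hs0 : 0 < s := div_pos (by linarith) (by nlinarith)
    have hs1 : s < 1 := by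
      have := hs.2
      rwa [hsc, norm_real, Real.norm_of_nonneg hs0.le] at this
    have hq0 : 0 < μ ^ 4 := by positivity
    have hq1 : μ ^ 4 < 1 := pow_lt_one₀ h0.le h1 (by norm_num)
    have ht : ∀ j : ℕ, 0 < (μ ^ 4) ^ j * s ∧ (μ ^ 4) ^ j * s < 1 := fun j => by
      refine ⟨by positivity, ?_⟩
      have : (μ ^ 4) ^ j ≤ 1 := pow_le_one₀ hq0.le hq1.le
      nlinarith
    have htne : ∀ j : ℕ, (1 + μ * ((μ : ℂ) ^ 4) ^ j * s : ℂ) ≠ 0 := fun j => by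
      have : 1 + μ * (μ ^ 4) ^ j * s ≠ 0 := by positivity
      exact_mod_cast this
    have hinv : ∀ j : ℕ, diskInv μ (diskMap μ (((μ : ℂ) ^ 4) ^ j * s)) = ((μ : ℂ) ^ 4) ^ j * s :=
      fun j => diskInv_diskMap h0 h1 (by rw [← mul_assoc]; exact htne j)
    have hpow : Tendsto (fun j : ℕ => ((μ : ℂ) ^ 4) ^ j * s) atTop (𝓝 0) := by
      have : ‖((μ : ℂ) ^ 4)‖ < 1 := by rw [norm_pow, hμn]; exact hq1
      simpa using (tendsto_pow_atTop_nhds_zero_of_norm_lt_one this).mul_const (s : ℂ)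
    have hlim : Tendsto (fun j : ℕ => diskMap μ (((μ : ℂ) ^ 4) ^ j * s)) atTop (𝓝[≠] (μ : ℂ)) := by
      refine tendsto_nhdsWithin_of_tendsto_nhds_of_eventually_within _ ?_ ?_
      · have hc : ContinuousAt (diskMap μ) 0 :=
          (differentiableAt_diskMap (by simp)).continuousAt
        have := hc.tendsto.comp hpow
        simpa [diskMap, Function.comp_def] using this
      · refine Eventually.of_forall fun j h => ?_
        have h2 := hinv j
        rw [mem_singleton_iff.1 h, diskInv, sub_self, zero_div] at h2
        have h3 := (ht j).1
        have : ((((μ ^ 4) ^ j * s : ℝ)) : ℂ) = 0 := by push_cast; exact h2.symm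
        rw [ofReal_eq_zero] at this
        linarith
    have hfr : ∃ᶠ w in 𝓝[≠] (μ : ℂ), h w - φ (psi R x) = 0 := by
      refine hlim.frequently (Eventually.frequently (Eventually.of_forall fun j => ?_))
      have hmap : diskMap μ (((μ : ℂ) ^ 4) ^ j * s) =
          (((((μ ^ 4) ^ j * s + μ) / (1 + μ * ((μ ^ 4) ^ j * s)) : ℝ)) : ℂ) := by
        rw [diskMap]; push_cast; rfl
      obtain ⟨h5, h6⟩ := ht j
      have hw : diskMap μ (((μ : ℂ) ^ 4) ^ j * s) ∈ wideAnnulus μ (2 / R) := by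
        refine annulus_subset_wideAnnulus h0 h1 hR ?_
        have hp : 0 < 1 + μ * ((μ ^ 4) ^ j * s) := by positivity
        constructor
        · rw [hmap, norm_real, Real.norm_of_nonneg (by positivity), lt_div_iff₀ hp]
          have : 0 < (1 - μ ^ 2) * ((μ ^ 4) ^ j * s) := mul_pos (by nlinarith) h5
          nlinarith
        · rw [hmap, norm_real, Real.norm_of_nonneg (by positivity), div_lt_one hp]
          nlinarith
      have h7 := (eventuallyEq_phi_comp h0 h1 hR hφ hH hm.le hh hw (j := j) (s := s)
        (by rw [← hsc]; exact hs) (hinv j)).eq_of_nhds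
      have hμ : (μ : ℂ) ≠ 0 := by exact_mod_cast h0.ne'
      rw [h7, hinv, mul_div_cancel_left₀ _ (pow_ne_zero _ (pow_ne_zero _ hμ)), ← hsc, annulusMap,
        diskMap_diskInv h0 h1 hne, sub_self]
    have hm2 : MeromorphicAt (fun w => h w - φ (psi R x)) μ := hmer.sub (MeromorphicAt.const _ _)
    rcases hm2.eventually_eq_zero_or_eventually_ne_zero with h8 | h8
    · filter_upwards [h8] with w hw using sub_eq_zero.1 hw
    · exact absurd h8 hfr
  obtain ⟨x, hx, hx1⟩ := exists_between h2R
  obtain ⟨y, hy, hy1⟩ := exists_between hx1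
  obtain ⟨w, hw1, hw2⟩ := ((key x hx hx1).and (key y (hx.trans hy) hy1)).exists
  have hmem : ∀ x : ℝ, 2 / R < x → x < 1 → (x : ℂ) ∈ outside (2 / R) ∧
      psi R x ∈ interiorDomain (curve R) := by
    intro x hx hx1
    have hxn : ‖(x : ℂ)‖ = x := by rw [norm_real, Real.norm_of_nonneg (by linarith)]
    refine ⟨show 2 / R < ‖(x : ℂ)‖ by rwa [hxn], ?_⟩
    rw [interiorDomain_curve h0 h1 hR]
    exact mem_image_of_mem _ (mem_innerPreimage_of_mem_annulus hR2 ⟨by rwa [hxn], by rwa [hxn]⟩)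
  have h3 := hφ.bijOn.injOn (hmem x hx hx1).2 (hmem y (hx.trans hy) hy1).2 (hw1.symm.trans hw2)
  have h4 := psi_injOn hR2 (hmem x hx hx1).1 (hmem y (hx.trans hy) hy1).1 h3
  rw [ofReal_inj] at h4
  linarith

end Continuation

end ZhukovskyDomain

/-! ### The branch of the square root and the moduli of the roots. -/

namespace ZhukovskyDomain

open Complex Metric Set Filter Topology ComplexConjugate

section Branch

variable {R : ℝ}

/-- Principal square roots of numbers with equal imaginary part lie in a common closed quadrant, so
their real inner product is nonnegative. -/
lemma norm_sub_le_norm_add_of_cpow (x y : ℂ) (hxy : x.im = y.im) :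
    ‖x ^ (1 / 2 : ℂ) - y ^ (1 / 2 : ℂ)‖ ≤ ‖x ^ (1 / 2 : ℂ) + y ^ (1 / 2 : ℂ)‖ := by
  have hre : ∀ x : ℂ, 0 ≤ (x ^ (1 / 2 : ℂ)).re := fun x => by
    rw [one_div, cpow_inv_two_re]; positivity
  have him : 0 ≤ (x ^ (1 / 2 : ℂ)).im * (y ^ (1 / 2 : ℂ)).im := by
    rw [one_div]
    rcases le_or_gt 0 x.im with h | h
    · rw [cpow_inv_two_im_eq_sqrt h, cpow_inv_two_im_eq_sqrt (hxy ▸ h)]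
      positivity
    · rw [cpow_inv_two_im_eq_neg_sqrt h, cpow_inv_two_im_eq_neg_sqrt (hxy ▸ h), neg_mul_neg]
      positivity
  have h2 := mul_nonneg (hre x) (hre y)
  rw [← sq_le_sq₀ (norm_nonneg _) (norm_nonneg _), Complex.sq_norm, Complex.sq_norm, normSq_apply,
    normSq_apply]
  simp only [sub_re, sub_im, add_re, add_im]
  nlinarith

/-- The numbers `R v₊ - 1` and `R v₋ - 1` are the squares of half the sum and half the difference of
`√(z - 2)` and `√(z + 2)`; their product is `1`, so the larger modulus is at least `1`. -/
lemma one_le_norm_vPlus (hR : 2 < R) (z : ℂ) : 1 ≤ ‖(R * vPlus R z - 1 : ℂ)‖ := by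
  have hp := congrArg norm (vPlus_mul_vMinus hR z)
  rw [norm_mul, norm_one] at hp
  have h := norm_sub_le_norm_add_of_cpow (z - 2) (z + 2) (by simp)
  have hsq : ∀ a : ℂ, (a ^ (1 / 2 : ℂ)) ^ 2 = a := fun a => by simp
  have ha := hsq (z - 2)
  have hb := hsq (z + 2)
  have e1 : (R * vPlus R z - 1 : ℂ) =
      (((z - 2) ^ (1 / 2 : ℂ) + (z + 2) ^ (1 / 2 : ℂ)) / 2) ^ 2 := by
    rw [mul_vPlus_sub_one hR, sqrtBranch]
    linear_combination (-1 / 4) * ha - (1 / 4) * hb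
  have e2 : (R * vMinus R z - 1 : ℂ) =
      (((z - 2) ^ (1 / 2 : ℂ) - (z + 2) ^ (1 / 2 : ℂ)) / 2) ^ 2 := by
    rw [mul_vMinus_sub_one hR, sqrtBranch]
    linear_combination (-1 / 4) * ha - (1 / 4) * hb
  have hle : ‖(R * vMinus R z - 1 : ℂ)‖ ≤ ‖(R * vPlus R z - 1 : ℂ)‖ := by
    rw [e1, e2, norm_pow, norm_pow, norm_div, norm_div]
    gcongr
  nlinarith [norm_nonneg (R * vMinus R z - 1 : ℂ)]

lemma eq_mul_of_mul_eq_one (hR : 2 < R) {w w' : ℂ}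
    (h : (R * w - 1) * (R * w' - 1) = (1 : ℂ)) : w' = w * (R * w' - 1) := by
  have h0 : (R : ℂ) ≠ 0 := by exact_mod_cast (by linarith : R ≠ 0)
  have : (R : ℂ) * w' = R * (w * (R * w' - 1)) := by linear_combination -h
  exact mul_left_cancel₀ h0 this

/-- The relation `w' = w (R w' - 1)` exchanges the two inequalities that define `innerPreimage R`.
-/
lemma mem_innerPreimage_of_mul_eq_one (hR : 2 < R) {w w' : ℂ} (hw : w ∈ innerPreimage R)
    (h : (R * w - 1) * (R * w' - 1) = (1 : ℂ)) : w' ∈ innerPreimage R := by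
  have h1 := congrArg norm (eq_mul_of_mul_eq_one hR h)
  have h2 := congrArg norm h
  rw [norm_mul] at h1 h2
  rw [norm_one] at h2
  obtain ⟨hw1, hw2⟩ := hw
  have hp : 0 < ‖(R * w' - 1 : ℂ)‖ := by
    refine norm_pos_iff.2 (right_ne_zero_of_mul_eq_one h)
  refine ⟨?_, ?_⟩ <;> · rw [h1]; nlinarith

lemma norm_vPlus_eq (hR : 2 < R) (z : ℂ) :
    ‖vPlus R z‖ = ‖vMinus R z‖ * ‖(R * vPlus R z - 1 : ℂ)‖ := by
  rw [← norm_mul, ← eq_mul_of_mul_eq_one hR ((mul_comm _ _).trans (vPlus_mul_vMinus hR z))]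

lemma norm_vMinus_le (hR : 2 < R) (z : ℂ) : ‖vMinus R z‖ ≤ ‖vPlus R z‖ := by
  rw [norm_vPlus_eq hR]
  exact le_mul_of_one_le_right (norm_nonneg _) (one_le_norm_vPlus hR z)

lemma v_mem_innerPreimage (hR : 2 < R) {z : ℂ} (hz : z ∈ psi R '' innerPreimage R) :
    vPlus R z ∈ innerPreimage R ∧ vMinus R z ∈ innerPreimage R := by
  obtain ⟨w, hw, rfl⟩ := hz
  have h := vPlus_mul_vMinus hR (psi R w)
  rcases (psi_eq_iff hR (mul_sub_one_ne_zero_of_mem hw)).1 rfl with e | e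
  · rw [← e] at h ⊢
    exact ⟨hw, mem_innerPreimage_of_mul_eq_one hR hw h⟩
  · rw [← e] at h ⊢
    exact ⟨mem_innerPreimage_of_mul_eq_one hR hw ((mul_comm _ _).trans h), hw⟩

/-- If `|u| = 1`, then `u⁻¹ = conj u`, so `z = 2 Re u`, while `R² |v₊|² = |u + 1|² = 2 + 2 Re u`. -/
lemma eq_ofReal_of_norm_eq_one (hR : 2 < R) {z : ℂ} (h : ‖(R * vPlus R z - 1 : ℂ)‖ = 1) :
    z = ((R ^ 2 * ‖vPlus R z‖ ^ 2 - 2 : ℝ) : ℂ) ∧ R ^ 2 * ‖vPlus R z‖ ^ 2 ≤ 4 := by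
  set u : ℂ := R * vPlus R z - 1 with hu
  have hz : u + u⁻¹ = z := psi_vPlus hR z
  have hinv : u⁻¹ = conj u := by
    rw [inv_def, normSq_eq_norm_sq, h]; simp
  have h1 : R ^ 2 * ‖vPlus R z‖ ^ 2 = 2 + 2 * u.re := by
    have e : R * vPlus R z = ((1 : ℝ) : ℂ) * u + ((1 : ℝ) : ℂ) := by simp [hu]
    have := norm_affine_sq 1 1 u
    rw [← e, norm_mul, norm_real, Real.norm_of_nonneg (by linarith), h, mul_pow] at this
    linarith
  have h2 : u.re ≤ 1 := h ▸ re_le_norm u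
  refine ⟨?_, by linarith⟩
  rw [h1, ← hz, hinv, add_conj]
  push_cast; ring

/-- As `x² - 4 ≤ 0`, the root `s` is purely imaginary and `|x + s|² = x² + (4 - x²)`; its sign plays
no role. -/
lemma norm_eq_one_of_mem_Icc (hR : 2 < R) {x : ℝ} (h1 : -2 ≤ x) (h2 : x ≤ 2) :
    ‖(R * vPlus R x - 1 : ℂ)‖ = 1 := by
  rw [mul_vPlus_sub_one hR]
  have hs := sqrtBranch_sq (x : ℂ)
  set s := sqrtBranch (x : ℂ)
  have hre := congrArg re hs
  have him := congrArg im hs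
  simp only [sq, mul_re, mul_im, sub_re, sub_im, ofReal_re, ofReal_im, re_ofNat, im_ofNat] at hre him
  have h0 : s.re = 0 := by
    have hmul : s.re * s.im = 0 := by linarith
    rcases mul_eq_zero.1 hmul with h | h
    · exact h
    · rw [h] at hre; nlinarith
  rw [h0] at hre
  rw [← pow_eq_one_iff_of_nonneg (norm_nonneg _) two_ne_zero, Complex.sq_norm, normSq_apply]
  have e1 : ((x + s) / 2 : ℂ).re = x / 2 := by simp [h0]
  have e2 : ((x + s) / 2 : ℂ).im = s.im / 2 := by simp
  rw [e1, e2]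
  linarith

end Branch

/-! ### Solutions of largest modulus and their multiplicities. -/

section Solutions

variable {μ R : ℝ} {φ H h : ℂ → ℂ} {z : ℂ}

lemma exists_eq_pow_mul {q : ℝ} (h0 : 0 < q) (h1 : q < 1) {t : ℂ} (ht : t ≠ 0) (ht1 : ‖t‖ < 1) :
    ∃ (j : ℕ) (s : ℂ), t = (q : ℂ) ^ j * s ∧ q ≤ ‖s‖ ∧ ‖s‖ < 1 := by
  obtain ⟨n, hn1, hn2⟩ := exists_nat_pow_near_of_lt_one (norm_pos_iff.2 ht) ht1.le h0 h1
  have hq : (q : ℂ) ≠ 0 := by exact_mod_cast h0.ne'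
  have key : ∀ j : ℕ, q ^ (j + 1) ≤ ‖t‖ → ‖t‖ < q ^ j →
      ∃ (j : ℕ) (s : ℂ), t = (q : ℂ) ^ j * s ∧ q ≤ ‖s‖ ∧ ‖s‖ < 1 := by
    intro j h2 h3
    have hn : ‖t / (q : ℂ) ^ j‖ = ‖t‖ / q ^ j := by
      rw [norm_div, norm_pow, norm_real, Real.norm_of_nonneg h0.le]
    refine ⟨j, t / (q : ℂ) ^ j, (mul_div_cancel₀ _ (pow_ne_zero _ hq)).symm, ?_, ?_⟩
    · rw [hn, le_div_iff₀ (by positivity), ← pow_succ']; exact h2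
    · rwa [hn, div_lt_one (by positivity)]
  -- The bracketing of `|t|` by powers is half-open the other way: if `|t| = q ^ n`, the index drops
  -- by one, and `n = 0` is excluded by `|t| < 1`.
  rcases hn2.lt_or_eq with h | h
  · exact key n hn1.le h
  · cases n with
    | zero => rw [pow_zero] at h; exact absurd h ht1.ne
    | succ n =>
      exact key n h.ge (by rw [h]; exact pow_lt_pow_right_of_lt_one₀ h0 h1 (Nat.lt_succ_self n))

lemma isOpen_interiorDomain_curve (h0 : 0 < μ) (h1 : μ < 1) (hR : R = μ + μ⁻¹) :
    IsOpen (interiorDomain (curve R)) := by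
  rw [interiorDomain_curve h0 h1 hR]; exact isOpen_inner h0 h1 hR

lemma mem_solutions (h0 : 0 < μ) (h1 : μ < 1) (hR : R = μ + μ⁻¹)
    (hφ : IsInteriorMap (interiorDomain (curve R)) φ) (hH : IsPeriodicContinuation μ R φ H)
    (hh : IsMeromorphicContinuation (psi R) φ μ h) {v : ℂ} (hv : v ∈ innerPreimage R)
    (hμ : μ < ‖v‖) : v ∈ solutions φ h μ (psi R v) := by
  have hev := eventuallyEq_phi_psi h0 h1 hR hφ hH hh hv hμ
  have hG := isOpen_interiorDomain_curve h0 h1 hR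
  have hmem : psi R v ∈ interiorDomain (curve R) := by
    rw [interiorDomain_curve h0 h1 hR]; exact mem_image_of_mem _ hv
  refine ⟨⟨hμ, hv.1⟩, ?_, hev.eq_of_nhds⟩
  have h2 : AnalyticAt ℂ φ (psi R v) := hφ.differentiableOn.analyticAt (hG.mem_nhds hmem)
  have h3 : AnalyticAt ℂ (psi R) v := by
    have hne : (R * v - 1 : ℂ) ≠ 0 := mul_sub_one_ne_zero_of_mem hv
    unfold psi
    exact AnalyticAt.add (by fun_prop) (AnalyticAt.inv (by fun_prop) hne)
  exact (AnalyticAt.comp h2 h3).congr hev.symm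

lemma eq_or_norm_lt_of_mem_solutions (h0 : 0 < μ) (h1 : μ < 1) (hR : R = μ + μ⁻¹)
    (hφ : IsInteriorMap (interiorDomain (curve R)) φ) (hH : IsPeriodicContinuation μ R φ H)
    (hh : IsMeromorphicContinuation (psi R) φ μ h) (hz : z ∈ interiorDomain (curve R)) {w : ℂ}
    (hw : w ∈ solutions φ h μ z) :
    (w = vPlus R z ∨ w = vMinus R z) ∨
      ∃ v, (v = vPlus R z ∨ v = vMinus R z) ∧ μ < ‖v‖ ∧ ‖w‖ < ‖v‖ := by
  obtain ⟨hwa, han, hval⟩ := hw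
  have hR2 := two_lt_of_eq h0 h1 hR
  have hww := annulus_subset_wideAnnulus h0 h1 hR hwa
  have hne := one_sub_mul_ne_zero_of_mem h0 h1 hR hww
  have ht0 := diskInv_ne_zero h0 h1 hR hww
  have hdm := diskMap_diskInv h0 h1 hne
  have ht1 : ‖diskInv μ w‖ < 1 := by
    rw [← norm_diskMap_lt_one_iff h0 h1 (one_add_mul_diskInv_ne_zero h0 h1 hne), hdm]
    exact hwa.2
  have hμ : (μ : ℂ) ≠ 0 := by exact_mod_cast h0.ne'
  have hq0 : 0 < μ ^ 4 := by positivity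
  have hq1 : μ ^ 4 < 1 := pow_lt_one₀ h0.le h1 (by norm_num)
  obtain ⟨j, s, hjs, hs, hs1⟩ := exists_eq_pow_mul hq0 hq1 ht0 ht1
  rw [ofReal_pow] at hjs
  have hc : ((μ : ℂ) ^ 4) ^ j ≠ 0 := pow_ne_zero _ (pow_ne_zero _ hμ)
  rcases lt_or_ge (μ ^ 2) ‖s‖ with hs2 | hs2
  · have hsa : s ∈ annulus (μ ^ 2) 1 := ⟨hs2, hs1⟩
    have hev := (eventuallyEq_phi_comp h0 h1 hR hφ hH le_rfl hh hww hsa hjs).eq_of_nhds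
    rw [hval, hjs, mul_div_cancel_left₀ _ hc] at hev
    have hPs : annulusMap μ R s = z :=
      hφ.bijOn.injOn (annulusMap_mem h0 h1 hR hsa) hz hev.symm
    have hv := (psi_eq_iff hR2 (mul_annulusMap_ne_zero h0 h1 hR hsa)).1 hPs
    cases j with
    | zero =>
      rw [pow_zero, one_mul] at hjs
      rw [← hjs, hdm] at hv
      exact Or.inl hv
    | succ j =>
      -- A shift by `j + 1` periods consists of `2 j + 2` scalings by `μ²`.
      have e : ((μ : ℂ) ^ 4) ^ (j + 1) * s = ((μ : ℂ) ^ 2) ^ ((2 * j + 1) + 1) * s := by ring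
      rw [e] at hjs
      have h3 := norm_diskMap_pow_mul_lt h0 h1 hR hs1 (2 * j + 1) (by
        rw [← hjs, hdm]; exact hwa.1)
      rw [← hjs, hdm] at h3
      exact Or.inr ⟨_, hv, h3⟩
  -- Here `|H| ≥ 1` at points arbitrarily near `s`, whereas continuity of `h` at `w` and `|φ(z)| <
  -- 1` would give `|H| < 1` on a punctured neighbourhood.
  · exfalso
    have hz1 : ‖h w‖ < 1 := by
      rw [hval]; simpa using hφ.bijOn.mapsTo hz
    have hfr := hH.frequently_one_le s hs hs2
    have hs0 : s ≠ 0 := right_ne_zero_of_mul (hjs ▸ ht0)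
    have hadd : (1 + μ * (((μ : ℂ) ^ 4) ^ j * s) : ℂ) ≠ 0 := by
      rw [← hjs]; exact one_add_mul_diskInv_ne_zero h0 h1 hne
    set g : ℂ → ℂ := fun x => diskMap μ (((μ : ℂ) ^ 4) ^ j * x) with hg
    have hgs : g s = w := by rw [hg]; simp only; rw [← hjs, hdm]
    have hnear : ∀ᶠ x in 𝓝 s, (1 + μ * (((μ : ℂ) ^ 4) ^ j * x) : ℂ) ≠ 0 := by
      have : ContinuousAt (fun x : ℂ => (1 + μ * (((μ : ℂ) ^ 4) ^ j * x) : ℂ)) s := by fun_prop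
      exact this.eventually_ne hadd
    have hgT : Tendsto g (𝓝[≠] s) (𝓝[≠] w) := by
      refine tendsto_nhdsWithin_of_tendsto_nhds_of_eventually_within _ ?_ ?_
      · have hcg : ContinuousAt g s := by
          refine ContinuousAt.comp (g := diskMap μ) ?_ (by fun_prop)
          exact (differentiableAt_diskMap hadd).continuousAt
        have := hcg.tendsto
        rw [hgs] at this
        exact this.mono_left nhdsWithin_le_nhds
      · filter_upwards [nhdsWithin_le_nhds hnear, self_mem_nhdsWithin] with x hx hxs hxw
        have h3 := diskInv_diskMap h0 h1 hx
        rw [show diskMap μ (((μ : ℂ) ^ 4) ^ j * x) = w from hxw, hjs] at h3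
        exact hxs (mul_left_cancel₀ hc h3).symm
    have hlt : ∀ᶠ x in 𝓝[≠] s, ‖h (g x)‖ < 1 :=
      hgT.eventually (nhdsWithin_le_nhds
        (han.continuousAt.norm.eventually_lt continuousAt_const hz1))
    have heq := hgT.eventually (eventuallyEq_comp_diskInv h0 h1 hR hH le_rfl hh hww)
    refine hfr ?_
    filter_upwards [hlt, heq, nhdsWithin_le_nhds hnear,
      nhdsWithin_le_nhds (isOpen_ne.mem_nhds hs0)] with x hx1 hx2 hx3 hx4
    rw [hx2, Function.comp_apply, hg, diskInv_diskMap h0 h1 hx3, hH.periodic x hx4 j] at hx1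
    exact not_le.2 hx1

lemma analyticAt_psi {v : ℂ} (hv : (R * v - 1 : ℂ) ≠ 0) : AnalyticAt ℂ (psi R) v := by
  unfold psi
  exact AnalyticAt.add (by fun_prop) (AnalyticAt.inv (by fun_prop) hv)

/-- Near `v` the function `h` is `φ ∘ psi R`, and `φ'` has no zeros, so `φ` does not affect the
order. -/
lemma analyticOrderAt_sub_eq (h0 : 0 < μ) (h1 : μ < 1) (hR : R = μ + μ⁻¹)
    (hφ : IsInteriorMap (interiorDomain (curve R)) φ) (hH : IsPeriodicContinuation μ R φ H)
    (hh : IsMeromorphicContinuation (psi R) φ μ h) {v : ℂ} (hv : v ∈ innerPreimage R)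
    (hμ : μ < ‖v‖) : analyticOrderAt (fun w => h w - φ (psi R v)) v =
      analyticOrderAt (fun w => psi R w - psi R v) v := by
  have hev := eventuallyEq_phi_psi h0 h1 hR hφ hH hh hv hμ
  have hG := isOpen_interiorDomain_curve h0 h1 hR
  have hmem : psi R v ∈ interiorDomain (curve R) := by
    rw [interiorDomain_curve h0 h1 hR]; exact mem_image_of_mem _ hv
  have h2 : AnalyticAt ℂ φ (psi R v) := hφ.differentiableOn.analyticAt (hG.mem_nhds hmem)
  have h4 := h2.analyticOrderAt_sub_eq_one_of_deriv_ne_zero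
    (deriv_ne_zero_of_injOn hG hφ.differentiableOn hφ.bijOn.injOn hmem)
  have h5 := AnalyticAt.analyticOrderAt_comp (f := fun y => φ y - φ (psi R v)) (g := psi R)
    (h2.sub analyticAt_const) (analyticAt_psi (mul_sub_one_ne_zero_of_mem hv))
  rw [h4, one_mul] at h5
  rw [← h5]
  refine analyticOrderAt_congr ?_
  filter_upwards [hev] with w hw
  rw [hw, Function.comp_apply]

lemma analyticOrderAt_psi_sub_of_ne (hR : 2 < R) {v : ℂ} (hv : (R * v - 1 : ℂ) ≠ 0)
    (h : (R * v - 1 : ℂ) ^ 2 ≠ 1) : analyticOrderAt (fun w => psi R w - psi R v) v = 1 := by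
  refine (analyticAt_psi hv).analyticOrderAt_sub_eq_one_of_deriv_ne_zero ?_
  have h0 : (R : ℂ) ≠ 0 := by exact_mod_cast (by linarith : R ≠ 0)
  rw [(hasDerivAt_psi hv).deriv, Ne, sub_eq_zero, eq_div_iff (pow_ne_zero 2 hv)]
  intro h2
  exact h (mul_left_cancel₀ h0 (by rw [h2, mul_one]))

/-- Here `psi R w - 2 = (u - 1)² / u` with `u - 1 = R (w - v)`. -/
lemma analyticOrderAt_psi_sub_of_eq (hR : 2 < R) {v : ℂ} (hv : (R * v - 1 : ℂ) = 1) :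
    analyticOrderAt (fun w => psi R w - psi R v) v = 2 := by
  have hv0 : (R * v - 1 : ℂ) ≠ 0 := by rw [hv]; exact one_ne_zero
  have h0 : (R : ℂ) ≠ 0 := by exact_mod_cast (by linarith : R ≠ 0)
  have hg : AnalyticAt ℂ (fun w : ℂ => (R : ℂ) ^ 2 * (R * w - 1)⁻¹) v :=
    AnalyticAt.mul (by fun_prop) (AnalyticAt.inv (by fun_prop) hv0)
  refine (((analyticAt_psi hv0).sub analyticAt_const).analyticOrderAt_eq_natCast (n := 2)).2
    ⟨_, hg, by rw [hv]; simpa using h0, ?_⟩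
  have hc : ContinuousAt (fun w : ℂ => (R * w - 1 : ℂ)) v := by fun_prop
  filter_upwards [hc.eventually_ne hv0] with w hw
  have hvw : (w - v) * R = (R * w - 1 : ℂ) - 1 := by linear_combination -hv
  have e : (w - v) ^ 2 • ((R : ℂ) ^ 2 * (R * w - 1)⁻¹) =
      ((R * w - 1 : ℂ) - 1) ^ 2 * (R * w - 1 : ℂ)⁻¹ := by
    rw [← hvw, smul_eq_mul]; ring
  change psi R w - psi R v = _
  rw [e, psi, psi, hv]
  set u : ℂ := R * w - 1
  field_simp; ring

lemma sigma_eq (h0 : 0 < μ) (h1 : μ < 1) (hR : R = μ + μ⁻¹)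
    (hφ : IsInteriorMap (interiorDomain (curve R)) φ) (hH : IsPeriodicContinuation μ R φ H)
    (hh : IsMeromorphicContinuation (psi R) φ μ h) :
    sigma (interiorDomain (curve R)) φ h μ =
      {z | z ∈ interiorDomain (curve R) ∧ μ < ‖vPlus R z‖} := by
  have hR2 := two_lt_of_eq h0 h1 hR
  ext z
  refine and_congr_right fun hz => ?_
  have hle := norm_vMinus_le hR2 z
  constructor
  · rintro ⟨w, hw⟩
    have hwμ : μ < ‖w‖ := hw.1.1
    rcases eq_or_norm_lt_of_mem_solutions h0 h1 hR hφ hH hh hz hw with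
      (rfl | rfl) | ⟨v, rfl | rfl, hv, -⟩
    · exact hwμ
    · exact hwμ.trans_le hle
    · exact hv
    · exact hv.trans_le hle
  · intro hμ
    have hz' := hz
    rw [interiorDomain_curve h0 h1 hR] at hz'
    have := mem_solutions h0 h1 hR hφ hH hh (v_mem_innerPreimage hR2 hz').1 hμ
    rw [psi_vPlus hR2] at this
    exact ⟨_, this⟩

lemma largestSolutions_subset (h0 : 0 < μ) (h1 : μ < 1) (hR : R = μ + μ⁻¹)
    (hφ : IsInteriorMap (interiorDomain (curve R)) φ) (hH : IsPeriodicContinuation μ R φ H)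
    (hh : IsMeromorphicContinuation (psi R) φ μ h) (hz : z ∈ interiorDomain (curve R)) {ω : ℂ}
    (hω : ω ∈ largestSolutions φ h μ z) : ω = vPlus R z ∨ ω = vMinus R z := by
  have hR2 := two_lt_of_eq h0 h1 hR
  have hz' := hz
  rw [interiorDomain_curve h0 h1 hR] at hz'
  rcases eq_or_norm_lt_of_mem_solutions h0 h1 hR hφ hH hh hz hω.1 with h | ⟨v, hv, hμ, hlt⟩
  · exact h
  · have hvi : v ∈ innerPreimage R ∧ psi R v = z := by
      rcases hv with rfl | rfl
      · exact ⟨(v_mem_innerPreimage hR2 hz').1, psi_vPlus hR2 z⟩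
      · exact ⟨(v_mem_innerPreimage hR2 hz').2, psi_vMinus hR2 z⟩
    have hs := mem_solutions h0 h1 hR hφ hH hh hvi.1 hμ
    rw [hvi.2] at hs
    exact absurd (hω.2 v hs) (not_le.2 hlt)

lemma largestSolutions_eq (h0 : 0 < μ) (h1 : μ < 1) (hR : R = μ + μ⁻¹)
    (hφ : IsInteriorMap (interiorDomain (curve R)) φ) (hH : IsPeriodicContinuation μ R φ H)
    (hh : IsMeromorphicContinuation (psi R) φ μ h) (hz : z ∈ interiorDomain (curve R))
    (hμ : μ < ‖vPlus R z‖) : largestSolutions φ h μ z =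
      {ω | (ω = vPlus R z ∨ ω = vMinus R z) ∧ ‖ω‖ = ‖vPlus R z‖} := by
  have hR2 := two_lt_of_eq h0 h1 hR
  have hz' := hz
  rw [interiorDomain_curve h0 h1 hR] at hz'
  have hle := norm_vMinus_le hR2 z
  have hps := mem_solutions h0 h1 hR hφ hH hh (v_mem_innerPreimage hR2 hz').1 hμ
  rw [psi_vPlus hR2] at hps
  have hmax : ∀ w ∈ solutions φ h μ z, ‖w‖ ≤ ‖vPlus R z‖ := by
    intro w hw
    rcases eq_or_norm_lt_of_mem_solutions h0 h1 hR hφ hH hh hz hw with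
      (rfl | rfl) | ⟨v, rfl | rfl, -, hlt⟩
    · exact le_rfl
    · exact hle
    · exact hlt.le
    · exact hlt.le.trans hle
  ext ω
  constructor
  · intro hω
    exact ⟨largestSolutions_subset h0 h1 hR hφ hH hh hz hω,
      le_antisymm (hmax _ hω.1) (hω.2 _ hps)⟩
  · rintro ⟨rfl | rfl, hn⟩
    · exact ⟨hps, hmax⟩
    · have hms := mem_solutions h0 h1 hR hφ hH hh (v_mem_innerPreimage hR2 hz').2 (hn ▸ hμ)
      rw [psi_vMinus hR2] at hms
      exact ⟨hms, fun w hw => (hmax w hw).trans hn.ge⟩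

lemma analyticOrderNatAt_eq (h0 : 0 < μ) (h1 : μ < 1) (hR : R = μ + μ⁻¹)
    (hφ : IsInteriorMap (interiorDomain (curve R)) φ) (hH : IsPeriodicContinuation μ R φ H)
    (hh : IsMeromorphicContinuation (psi R) φ μ h) (hz : z ∈ interiorDomain (curve R)) {v : ℂ}
    (hv : v = vPlus R z ∨ v = vMinus R z) (hμ : μ < ‖v‖) :
    analyticOrderNatAt (fun w => h w - φ z) v = if (R * v - 1 : ℂ) = 1 then 2 else 1 := by
  have hR2 := two_lt_of_eq h0 h1 hR
  have hz' := hz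
  rw [interiorDomain_curve h0 h1 hR] at hz'
  have hvi : v ∈ innerPreimage R ∧ psi R v = z := by
    rcases hv with rfl | rfl
    · exact ⟨(v_mem_innerPreimage hR2 hz').1, psi_vPlus hR2 z⟩
    · exact ⟨(v_mem_innerPreimage hR2 hz').2, psi_vMinus hR2 z⟩
  have hord := analyticOrderAt_sub_eq h0 h1 hR hφ hH hh hvi.1 hμ
  rw [hvi.2] at hord
  rw [analyticOrderNatAt, hord, ← hvi.2]
  split_ifs with hu
  · rw [analyticOrderAt_psi_sub_of_eq hR2 hu]; rfl
  · rw [analyticOrderAt_psi_sub_of_ne hR2 (mul_sub_one_ne_zero_of_mem hvi.1)]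
    · rfl
    · rw [Ne, sq_eq_one_iff, not_or]
      -- The other critical point, `u = -1`, is `v = 0`, which `μ < |v|` excludes.
      refine ⟨hu, fun h2 => ?_⟩
      have hRc : (R : ℂ) ≠ 0 := by exact_mod_cast (by linarith : R ≠ 0)
      have : (R : ℂ) * v = 0 := by linear_combination h2
      rw [(mul_eq_zero.1 this).resolve_left hRc, norm_zero] at hμ
      linarith

open Classical in
-- If `|R v₊ - 1| = 1`, the roots have equal moduli and are either two simple solutions or, when `R
-- v₊ - 1 = 1`, a single double one. Otherwise `|v₋| < |v₊|` and only the simple solution `v₊`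
-- counts.
lemma finite_and_sum_largestSolutions (h0 : 0 < μ) (h1 : μ < 1) (hR : R = μ + μ⁻¹)
    (hφ : IsInteriorMap (interiorDomain (curve R)) φ) (hH : IsPeriodicContinuation μ R φ H)
    (hh : IsMeromorphicContinuation (psi R) φ μ h) (hz : z ∈ interiorDomain (curve R))
    (hμ : μ < ‖vPlus R z‖) : (largestSolutions φ h μ z).Finite ∧
      ∑ᶠ ω ∈ largestSolutions φ h μ z, analyticOrderNatAt (fun w => h w - φ z) ω =
        if ‖(R * vPlus R z - 1 : ℂ)‖ = 1 then 2 else 1 := by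
  have hR2 := two_lt_of_eq h0 h1 hR
  have hRc : (R : ℂ) ≠ 0 := by exact_mod_cast (by linarith : R ≠ 0)
  have hnorm := norm_vPlus_eq hR2 z
  have hprod := vPlus_mul_vMinus hR2 z
  rw [largestSolutions_eq h0 h1 hR hφ hH hh hz hμ]
  have hord := fun v hv => analyticOrderNatAt_eq h0 h1 hR hφ hH hh hz (v := v) hv
  split_ifs with hu
  · rw [hu, mul_one] at hnorm
    have hset : {ω | (ω = vPlus R z ∨ ω = vMinus R z) ∧ ‖ω‖ = ‖vPlus R z‖} =
        {vPlus R z, vMinus R z} := by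
      ext ω
      constructor
      · exact fun h => h.1
      · rintro (rfl | rfl)
        · exact ⟨Or.inl rfl, rfl⟩
        · exact ⟨Or.inr rfl, hnorm.symm⟩
    rw [hset]
    refine ⟨Set.toFinite _, ?_⟩
    by_cases h2 : (R * vPlus R z - 1 : ℂ) = 1
    · have h3 : vMinus R z = vPlus R z := by
        rw [h2, one_mul, ← h2] at hprod
        exact mul_left_cancel₀ hRc (by linear_combination hprod + h2)
      rw [h3, pair_eq_singleton, finsum_mem_singleton, hord _ (Or.inl rfl) hμ, if_pos h2]
    · have h2' : (R * vMinus R z - 1 : ℂ) ≠ 1 := fun h => by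
        rw [h, mul_one] at hprod; exact h2 hprod
      have hneq : vPlus R z ≠ vMinus R z := by
        intro h3
        rw [← h3, mul_self_eq_one_iff] at hprod
        rcases hprod with h4 | h4
        · exact h2 h4
        · have : (R : ℂ) * vPlus R z = 0 := by linear_combination h4
          rw [(mul_eq_zero.1 this).resolve_left hRc, norm_zero] at hμ
          linarith
      rw [finsum_mem_pair hneq, hord _ (Or.inl rfl) hμ, hord _ (Or.inr rfl) (hnorm ▸ hμ),
        if_neg h2, if_neg h2']
  · have hgt : 1 < ‖(R * vPlus R z - 1 : ℂ)‖ := lt_of_le_of_ne (one_le_norm_vPlus hR2 z) (Ne.symm hu)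
    have hset : {ω | (ω = vPlus R z ∨ ω = vMinus R z) ∧ ‖ω‖ = ‖vPlus R z‖} = {vPlus R z} := by
      ext ω
      constructor
      · rintro ⟨rfl | rfl, hn⟩
        · rfl
        · exfalso
          rw [hn] at hnorm
          nlinarith
      · rintro rfl
        exact ⟨Or.inl rfl, rfl⟩
    rw [hset]
    refine ⟨Set.toFinite _, ?_⟩
    rw [finsum_mem_singleton, hord _ (Or.inl rfl) hμ, if_neg]
    intro h2
    rw [h2, norm_one] at hu
    exact hu rfl

lemma mem_sigmaP_iff (h0 : 0 < μ) (h1 : μ < 1) (hR : R = μ + μ⁻¹)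
    (hφ : IsInteriorMap (interiorDomain (curve R)) φ) (hH : IsPeriodicContinuation μ R φ H)
    (hh : IsMeromorphicContinuation (psi R) φ μ h) {p : ℕ} :
    z ∈ sigmaP (interiorDomain (curve R)) φ h μ p ↔ z ∈ interiorDomain (curve R) ∧
      μ < ‖vPlus R z‖ ∧ (1 < ‖(R * vPlus R z - 1 : ℂ)‖ ∧ p = 1 ∨
        ‖(R * vPlus R z - 1 : ℂ)‖ = 1 ∧ p = 2) := by
  have hR2 := two_lt_of_eq h0 h1 hR
  have hle := one_le_norm_vPlus hR2 z
  rw [sigmaP, mem_ofPred_eq, sigma_eq h0 h1 hR hφ hH hh, mem_ofPred_eq, and_assoc]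
  refine and_congr_right fun hz => and_congr_right fun hμ => ?_
  obtain ⟨hf, hsum⟩ := finite_and_sum_largestSolutions h0 h1 hR hφ hH hh hz hμ
  rw [hsum, and_iff_right hf]
  rcases hle.eq_or_lt with h2 | h2
  · rw [if_pos h2.symm, ← h2]; simp [eq_comm]
  · rw [if_neg h2.ne']; simp [h2, h2.ne', eq_comm]

lemma sigmaP_one (h0 : 0 < μ) (h1 : μ < 1) (hR : R = μ + μ⁻¹)
    (hφ : IsInteriorMap (interiorDomain (curve R)) φ) (hH : IsPeriodicContinuation μ R φ H)
    (hh : IsMeromorphicContinuation (psi R) φ μ h) :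
    sigmaP (interiorDomain (curve R)) φ h μ 1 =
      psi R '' {w | ‖w‖ < 1 ∧ μ < ‖w‖ ∧ 1 / R < ‖w - 1 / (R : ℂ)‖} := by
  have hR2 := two_lt_of_eq h0 h1 hR
  have hR0 : 0 < R := by linarith
  have hRc : (R : ℂ) ≠ 0 := by exact_mod_cast hR0.ne'
  have hcirc : ∀ w : ℂ, 1 / R < ‖w - 1 / (R : ℂ)‖ ↔ 1 < ‖(R * w - 1 : ℂ)‖ := by
    intro w
    have : (R * w - 1 : ℂ) = R * (w - 1 / (R : ℂ)) := by field_simp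
    rw [this, norm_mul, norm_real, Real.norm_of_nonneg hR0.le, div_lt_iff₀' hR0]
  ext z
  rw [mem_sigmaP_iff h0 h1 hR hφ hH hh]
  constructor
  · rintro ⟨hz, hμ, h | h⟩
    · rw [interiorDomain_curve h0 h1 hR] at hz
      exact ⟨vPlus R z, ⟨(v_mem_innerPreimage hR2 hz).1.1, hμ, (hcirc _).2 h.1⟩, psi_vPlus hR2 z⟩
    · exact absurd h.2 (by norm_num)
  · rintro ⟨w, ⟨hw1, hμ, hw2⟩, rfl⟩
    rw [hcirc] at hw2
    have hwi : w ∈ innerPreimage R := ⟨hw1, hw1.trans hw2⟩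
    -- The alternative `w = v₋` fails because `|R v₋ - 1| ≤ 1`.
    have hw : w = vPlus R (psi R w) := by
      refine ((psi_eq_iff hR2 (mul_sub_one_ne_zero_of_mem hwi)).1 rfl).resolve_right fun h => ?_
      have h3 := congrArg norm (vPlus_mul_vMinus hR2 (psi R w))
      have h4 := one_le_norm_vPlus hR2 (psi R w)
      rw [← h, norm_mul, norm_one] at h3
      nlinarith
    rw [← hw]
    refine ⟨?_, hμ, Or.inl ⟨hw2, rfl⟩⟩
    rw [interiorDomain_curve h0 h1 hR]
    exact mem_image_of_mem _ hwi

lemma sigmaP_two (h0 : 0 < μ) (h1 : μ < 1) (hR : R = μ + μ⁻¹)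
    (hφ : IsInteriorMap (interiorDomain (curve R)) φ) (hH : IsPeriodicContinuation μ R φ H)
    (hh : IsMeromorphicContinuation (psi R) φ μ h) :
    sigmaP (interiorDomain (curve R)) φ h μ 2 =
      (fun x : ℝ => (x : ℂ)) '' Set.Ioc ((1 + μ ^ 2) ^ 2 - 2) 2 := by
  have hR2 := two_lt_of_eq h0 h1 hR
  have hμR : R * μ = 1 + μ ^ 2 := by rw [hR]; field_simp; ring
  -- On this set `z = R² |v₊|² - 2`, so the bound `|v₊| > μ` becomes `z > R² μ² - 2`.
  have hsq : (1 + μ ^ 2) ^ 2 = R ^ 2 * μ ^ 2 := by rw [← hμR]; ring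
  have hcmp : ∀ r : ℝ, 0 ≤ r → (μ < r ↔ R ^ 2 * μ ^ 2 < R ^ 2 * r ^ 2) := fun r hr => by
    rw [mul_lt_mul_iff_right₀ (by positivity), sq_lt_sq₀ h0.le hr]
  ext z
  rw [mem_sigmaP_iff h0 h1 hR hφ hH hh, hcmp _ (norm_nonneg _)]
  constructor
  · rintro ⟨hz, hμ, h | h⟩
    · exact absurd h.2 (by norm_num)
    · obtain ⟨h3, h4⟩ := eq_ofReal_of_norm_eq_one hR2 h.1
      exact ⟨_, ⟨by rw [hsq]; linarith, by linarith⟩, h3.symm⟩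
  · rintro ⟨x, ⟨hx1, hx2⟩, rfl⟩
    rw [hsq] at hx1
    have h5 := norm_eq_one_of_mem_Icc hR2 (x := x) (by nlinarith [sq_nonneg (R * μ)]) hx2
    obtain ⟨h3, h4⟩ := eq_ofReal_of_norm_eq_one hR2 h5
    have h6 : x = R ^ 2 * ‖vPlus R (x : ℂ)‖ ^ 2 - 2 := by exact_mod_cast h3
    refine ⟨?_, by linarith, Or.inr ⟨h5, rfl⟩⟩
    rw [interiorDomain_curve h0 h1 hR]
    -- Membership uses `R² |v₊|² = x + 2 ≤ 4 < R²`, hence `|v₊| < 1 = |R v₊ - 1|`.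
    refine ⟨vPlus R x, ?_, psi_vPlus hR2 _⟩
    have h7 : ‖vPlus R (x : ℂ)‖ < 1 := by
      by_contra! h8
      nlinarith [norm_nonneg (vPlus R (x : ℂ)), mul_le_mul h8 h8 zero_le_one (norm_nonneg _)]
    exact ⟨h7, by rwa [h5]⟩

lemma eq_union (h0 : 0 < μ) (h1 : μ < 1) (hR : R = μ + μ⁻¹)
    (hφ : IsInteriorMap (interiorDomain (curve R)) φ) (hH : IsPeriodicContinuation μ R φ H)
    (hh : IsMeromorphicContinuation (psi R) φ μ h) :
    interiorDomain (curve R) = sigmaP (interiorDomain (curve R)) φ h μ 1 ∪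
      sigmaP (interiorDomain (curve R)) φ h μ 2 ∪ sigmaZero (interiorDomain (curve R)) φ h μ := by
  ext z
  rw [mem_union, mem_union, mem_sigmaP_iff h0 h1 hR hφ hH hh, mem_sigmaP_iff h0 h1 hR hφ hH hh,
    sigmaZero, Set.mem_sdiff, sigma_eq h0 h1 hR hφ hH hh, mem_ofPred_eq]
  have hle := (one_le_norm_vPlus (two_lt_of_eq h0 h1 hR) z).lt_or_eq
  rw [eq_comm (a := (1 : ℝ))] at hle
  tauto

end Solutions

/-- This number is the smaller root of `x² - R x + 1`, whose roots have product `1`. -/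
lemma small_root {R : ℝ} (hR : 2 < R) : 0 < (R - √(R ^ 2 - 4)) / 2 ∧ (R - √(R ^ 2 - 4)) / 2 < 1 ∧
    R = (R - √(R ^ 2 - 4)) / 2 + ((R - √(R ^ 2 - 4)) / 2)⁻¹ := by
  have hp : 0 < R ^ 2 - 4 := by nlinarith
  have hs := Real.sq_sqrt hp.le
  have hs0 := Real.sqrt_nonneg (R ^ 2 - 4)
  set s := √(R ^ 2 - 4)
  have h1 : s < R := by nlinarith
  have h2 : R - 2 < s := by nlinarith
  refine ⟨by linarith, by linarith, ?_⟩
  have h3 : R - s ≠ 0 := by linarith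
  field_simp
  nlinarith

end ZhukovskyDomain

open ZhukovskyDomain in
theorem proposition2 (R : ℝ) (hR : 2 < R) (G : Set ℂ) (hG : G = interiorDomain (curve R))
    (φ : ℂ → ℂ) (hφ : IsInteriorMap G φ) :
    IsExteriorMap (curve R) (psi R) ∧
    ∃ μ : ℝ, IsLeast (continuationRadii (psi R) φ) μ ∧
      μ = (R - √(R ^ 2 - 4)) / 2 ∧
      ∀ h : ℂ → ℂ, IsMeromorphicContinuation (psi R) φ μ h →
        sigma G φ h μ = {z | z ∈ G ∧ μ < ‖vPlus R z‖} ∧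
        (∀ z ∈ sigma G φ h μ, ∀ ω ∈ largestSolutions φ h μ z,
          ω = vPlus R z ∨ ω = vMinus R z) ∧
        G = sigmaP G φ h μ 1 ∪ sigmaP G φ h μ 2 ∪ sigmaZero G φ h μ ∧
        sigmaP G φ h μ 1 =
          psi R '' {w | ‖w‖ < 1 ∧ μ < ‖w‖ ∧ 1 / R < ‖w - 1 / (R : ℂ)‖} ∧
        sigmaP G φ h μ 2 =
          (fun x : ℝ => (x : ℂ)) '' Set.Ioc ((1 + μ ^ 2) ^ 2 - 2) 2 := by
  subst hG
  obtain ⟨h0, h1, hμ⟩ := small_root hR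
  obtain ⟨H, hH⟩ := exists_isPeriodicContinuation h0 h1 hμ hφ
  refine ⟨isExteriorMap_psi h0 h1 hμ, _,
    ⟨⟨h0.le, exists_isMeromorphicContinuation h0 h1 hμ hφ hH⟩, ?_⟩, rfl, fun h hh =>
    ⟨sigma_eq h0 h1 hμ hφ hH hh, fun z hz ω hω =>
      largestSolutions_subset h0 h1 hμ hφ hH hh hz.1 hω, eq_union h0 h1 hμ hφ hH hh,
      sigmaP_one h0 h1 hμ hφ hH hh, sigmaP_two h0 h1 hμ hφ hH hh⟩⟩
  rintro m ⟨-, h, hh⟩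
  exact le_of_isMeromorphicContinuation h0 h1 hμ hφ hH hh
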